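/- Let $\mathcal{O}$ be a Dedekind domain with fraction field $K$, and let $B$ be a quaternion algebra over $K$, i.e. a central simple $K$-algebra of dimension $4$. A \emph{lattice} in $B$ is a finitely generated $\mathcal{O}$-submodule of $B$ that spans $B$ over $K$; an \emph{order} is a lattice which is a subring with unity. For a lattice $\Lambda$ put $O_l(\Lambda)=\{x\in B: x\Lambda\subseteq\Lambda\}$, $O_r(\Lambda)=\{x\in B:\Lambda x\subseteq\Lambda\}$ and $\Lambda^{-1}=\{x\in B:\Lambda x\Lambda\subseteq\Lambda\}$; $\Lambda$ is \emph{invertible} if $\Lambda\Lambda^{-1}=O_l(\Lambda)$ and $\Lambda^{-1}\Lambda=O_r(\Lambda)$. For an order $O$, let $I(O)$ be the set of invertible lattices $I$ with $O_l(I)=O$. For lattices $\Lambda'\subseteq\Lambda$, the \emph{index} $[\Lambda:\Lambda']$ is the ideal of $\mathcal{O}$ generated by the determinants $\det\phi$ of all $\phi\in\operatorname{End}_K(B)$ with $\phi(\Lambda)\subseteq\Lambda'$. For orders $O'\subseteq O$ and $I\in I(O)$, put \[ \Psi_{O'}^{O}(I)=\{J\in I(O'): OJ=I\}. \] For a nonzero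 prime $\mathfrak{q}$ of $\mathcal{O}$ let $\mathcal{O}_{\mathfrak q}$, $K_{\mathfrak q}$ be the completions at $\mathfrak q$, $B_{\mathfrak q}=K_{\mathfrak q}\otimes_K B$, and for an $\mathcal{O}$-submodule $\Lambda$ of $B$ let $\Lambda_{\mathfrak q}$ be the $\mathcal{O}_{\mathfrak q}$-submodule of $B_{\mathfrak q}$ generated by $\Lambda$. The same definitions are used over $\mathcal{O}_{\mathfrak q}$. \textbf{Proposition.} Let $O'\subseteq O$ be orders in $B$ with $[O:O']=\mathfrak{p}^e$ for a nonzero prime ideal $\mathfrak{p}$ of $\mathcal{O}$ and some $e\ge 1$, and let $I\in I(O)$. (1) The map $J\mapsto J_{\mathfrak p}$ is a bijection from $\Psi_{O'}^{O}(I)$ onto $\Psi_{O'_{\mathfrak p}}^{O_{\mathfrak p}}(I_{\mathfrak p})$. (2) $\#\Psi_{O'}^{O}(I)=[O_{\mathfrak p}^\times:(O'_{\mathfrak p})^\times]$ (an equality of cardinal numbers). (3) There is $x\in B_{\mathfrak p}^\times$ with $I_{\mathfrak p}=O_{\mathfrak p}x$. For every such $x$ and every system $(\alpha_j)_j$ of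 representatives in $O_{\mathfrak p}^\times$ of $(O'_{\mathfrak p})^\times\backslash O_{\mathfrak p}^\times$, there is for each $j$ exactly one lattice $J_j$ in $B$ with \[ (J_j)_{\mathfrak q}=I_{\mathfrak q}\ \text{ for all } \mathfrak q\neq\mathfrak p,\qquad (J_j)_{\mathfrak p}=O'_{\mathfrak p}\,\alpha_j x ; \] the $J_j$ are pairwise distinct, and $\Psi_{O'}^{O}(I)=\{J_j\}_j$. -/

import Mathlib

open scoped TensorProduct

universe uR uK uB uι

noncomputable section

namespace QuaternionIdeals

/-! ### Lattices, orders and ideals in an algebra `B` over the fraction field `K` of `R`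

Lattices are `R`-submodules `Λ` of `B` with `Submodule.IsLattice K Λ` (finitely generated, spanning
`B` over `K`); a lattice that is a subring with unity is a subalgebra over `R`. The same definitions
serve for `(R, K, B)` and for its completions. -/

section General

variable {R : Type*} (K : Type*) {B : Type*} [CommRing R] [Field K] [Algebra R K] [Ring B]
  [Algebra K B] [Algebra R B] [IsScalarTower R K B]

/-- A subring `O` of `B` is an order if it is a lattice. -/
def IsOrder (O : Subalgebra R B) : Prop :=
  Submodule.IsLattice K (Subalgebra.toSubmodule O)

/-- The left order `{x ∈ B : x Λ ⊆ Λ}`. -/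
def leftOrder (Λ : Submodule R B) : Subalgebra R B where
  carrier := {x | ∀ y ∈ Λ, x * y ∈ Λ}
  mul_mem' {a b} ha hb := fun y hy => by
    rw [mul_assoc]
    exact ha _ (hb y hy)
  add_mem' {a b} ha hb := fun y hy => by
    rw [add_mul]
    exact Λ.add_mem (ha y hy) (hb y hy)
  algebraMap_mem' r := fun y hy => by
    rw [← Algebra.smul_def]
    exact Λ.smul_mem r hy

/-- The right order `{x ∈ B : Λ x ⊆ Λ}`. -/
def rightOrder (Λ : Submodule R B) : Subalgebra R B where
  carrier := {x | ∀ y ∈ Λ, y * x ∈ Λ}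
  mul_mem' {a b} ha hb := fun y hy => by
    rw [← mul_assoc]
    exact hb _ (ha y hy)
  add_mem' {a b} ha hb := fun y hy => by
    rw [mul_add]
    exact Λ.add_mem (ha y hy) (hb y hy)
  algebraMap_mem' r := fun y hy => by
    rw [← Algebra.commutes, ← Algebra.smul_def]
    exact Λ.smul_mem r hy

/-- The inverse `{x ∈ B : Λ x Λ ⊆ Λ}`. -/
def latticeInv (Λ : Submodule R B) : Submodule R B where
  carrier := {x | ∀ a ∈ Λ, ∀ b ∈ Λ, a * x * b ∈ Λ}
  add_mem' {x y} hx hy := fun a ha b hb => by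
    rw [mul_add, add_mul]
    exact Λ.add_mem (hx a ha b hb) (hy a ha b hb)
  zero_mem' := fun a _ b _ => by simp
  smul_mem' r x hx := fun a ha b hb => by
    rw [mul_smul_comm, smul_mul_assoc]
    exact Λ.smul_mem r (hx a ha b hb)

/-- Invertible lattices: `Λ Λ⁻¹ = O_l(Λ)` and `Λ⁻¹ Λ = O_r(Λ)`. -/
structure IsInvertibleLattice (Λ : Submodule R B) : Prop where
  isLattice : Submodule.IsLattice K Λ
  mul_inv : Λ * latticeInv Λ = Subalgebra.toSubmodule (leftOrder Λ)
  inv_mul : latticeInv Λ * Λ = Subalgebra.toSubmodule (rightOrder Λ)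

/-- The set `I(O)` of left `O`-ideals: invertible lattices whose left order is `O`. -/
def leftIdeals (O : Subalgebra R B) : Set (Submodule R B) :=
  {I | IsInvertibleLattice K I ∧ leftOrder I = O}

/-- `Ψ(I)`, the set of left `O'`-ideals `J` with `O J = I`. -/
def Psi (O' O : Subalgebra R B) (I : Submodule R B) : Set (Submodule R B) :=
  {J | J ∈ leftIdeals K O' ∧ Subalgebra.toSubmodule O * J = I}

/-- The index `[Λ : Λ']`, as an `R`-submodule of `K`: it is generated by the determinants of the
`K`-linear endomorphisms `φ` of `B` with `φ(Λ) ⊆ Λ'`. -/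
def latticeIndex (Λ Λ' : Submodule R B) : Submodule R K :=
  Submodule.span R {d | ∃ φ : Module.End K B, (∀ x ∈ Λ, φ x ∈ Λ') ∧ LinearMap.det φ = d}

/-- The translate `Λ x`. -/
def rightTranslate (Λ : Submodule R B) (x : B) : Submodule R B :=
  Λ.map (LinearMap.mulRight R x)

/-- The unit group of a subring `O` of `B`, as a subgroup of the unit group of `B`. -/
def unitGroup (O : Subalgebra R B) : Subgroup Bˣ :=
  O.toSubmonoid.units

end General

/-! ### Completions -/

section Completion

open IsDedekindDomain

variable {R K B : Type*} [CommRing R] [IsDedekindDomain R] [Field K] [Algebra R K]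
  [IsFractionRing R K] [Ring B] [Algebra K B] [Algebra R B] [IsScalarTower R K B]

variable (K B) in
/-- The completion `B_v = K_v ⊗ B` of `B` at `v`. -/
abbrev CompletedAlgebra (v : HeightOneSpectrum R) : Type _ :=
  v.adicCompletion K ⊗[K] B

variable (K) in
/-- The completion `Λ_v` of a submodule `Λ` of `B`: the `R_v`-submodule of `B_v` generated
by the image of `Λ`. -/
def completion (v : HeightOneSpectrum R) (Λ : Submodule R B) :
    Submodule (v.adicCompletionIntegers K) (CompletedAlgebra K B v) :=
  Submodule.span (v.adicCompletionIntegers K)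
    ((Algebra.TensorProduct.includeRight : B →ₐ[K] CompletedAlgebra K B v) '' (Λ : Set B))

variable (K) in
/-- The completion `O_v` of a subring `O` of `B`, as a subring of `B_v`; the underlying submodule
is the completion of the submodule `O`. -/
def completionOrder (v : HeightOneSpectrum R) (O : Subalgebra R B) :
    Subalgebra (v.adicCompletionIntegers K) (CompletedAlgebra K B v) :=
  (completion K v (Subalgebra.toSubmodule O)).toSubalgebra
    (Submodule.subset_span ⟨1, O.one_mem, map_one _⟩)
    (fun x y hx hy => by
      have h := Submodule.mul_mem_mul hx hy
      unfold completion at h ⊢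
      rw [Submodule.span_mul_span] at h
      refine Submodule.span_mono ?_ h
      rintro _ ⟨_, ⟨a, ha, rfl⟩, _, ⟨b, hb, rfl⟩, rfl⟩
      exact ⟨a * b, O.mul_mem ha hb, map_mul _ _ _⟩)

end Completion

end QuaternionIdeals

end

namespace QuaternionIdeals

/-! ### Base change of central simple algebras -/

section BaseChange

variable {K L B ι : Type*} [Field K] [Field L] [Algebra K L] [Ring B] [Algebra K B]

open TensorProduct

/-! The proof compares `Psi` with its analogue at `p`, where every invertible lattice is principal.

Global to local: an endomorphism `φ` of `B` with `φ(O) ⊆ O'` satisfies `det φ · O ⊆ O'`, by the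
adjugate matrix in a local basis. Hence `p ^ e O ⊆ O'`, and every `J` in `Psi` satisfies `p ^ e I ⊆
J ⊆ I`. Such a lattice agrees with `I` at every `q ≠ p` and is determined by its completion at `p`.
Conversely, any local lattice between `p ^ e I_p` and `I_p` is the completion of its intersection
with `I`, because `R` is dense in its completion (`completion_localSubmodule`). Invertibility passes
to this intersection by cutting an inverse out of `I⁻¹` in the same way (`localSubmodule_mem_Psi`).

Local: `B_p` is again central simple of dimension 4, and the completed ring is a henselian discrete
valuation ring. Then `exists_eq_rightTranslate` makes invertible lattices principal. Elements of an
order satisfy integral quadratic equations, so by Hensel's lemma either `z` or `1 - z` is invertible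
for each `z`, or the order has a nontrivial idempotent. If there is no such idempotent the order is
local, and some product in a decomposition of `1 ∈ Λ Λ⁻¹` is a unit. If there is one, the Peirce
decomposition either yields matrix units or has off-diagonal products in the maximal ideal; a
generator is explicit in both cases.

With `I_p = O_p x`, the local set therefore consists of the lattices `O'_p α x` with `α ∈ O_pˣ`, and
two of them coincide exactly when the `α` lie in the same coset `O'_pˣ α`. -/

/-- As a `B`-bimodule, `L ⊗ B` is a direct sum of copies of `B` indexed by a basis of `L`; this lets
the coordinates be treated one at a time. -/
lemma equivFinsuppOfBasisLeft_mul_mul [DecidableEq ι] (β : Module.Basis ι K L) (b c : B) (z : L ⊗[K] B) (i : ι) :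
    equivFinsuppOfBasisLeft β ((1 ⊗ₜ b) * z * (1 ⊗ₜ c)) i =
      b * equivFinsuppOfBasisLeft β z i * c := by
  induction z using TensorProduct.induction_on with
  | zero => simp
  | tmul l x => simp
  | add x y hx hy => simp only [mul_add, add_mul, map_add, Finsupp.add_apply, hx, hy]

/-- Each coordinate of `z` commutes with `B`, hence lies in `K`. Commutation is required only with
`1 ⊗ B`, which is what the minimal-support argument for simplicity provides. -/
lemma exists_eq_algebraMap_of_commute [Algebra.IsCentral K B] (z : L ⊗[K] B)
    (h : ∀ b : B, (1 ⊗ₜ b) * z = z * (1 ⊗ₜ b)) : ∃ l : L, z = algebraMap L (L ⊗[K] B) l := by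
  classical
  set β := Module.Basis.ofVectorSpace K L
  have hc : ∀ i, ∃ k : K, equivFinsuppOfBasisLeft β z i = algebraMap K B k := by
    intro i
    have hmem : equivFinsuppOfBasisLeft β z i ∈ Subalgebra.center K B := by
      rw [Subalgebra.mem_center_iff]
      intro b
      have h1 := equivFinsuppOfBasisLeft_mul_mul β b 1 z i
      have h2 := equivFinsuppOfBasisLeft_mul_mul β 1 b z i
      rw [← Algebra.TensorProduct.one_def, mul_one] at h1
      rw [← Algebra.TensorProduct.one_def, one_mul, ← h b] at h2
      simpa using h1.symm.trans h2
    obtain ⟨k, hk⟩ := Algebra.mem_bot.mp (Algebra.IsCentral.out hmem)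
    exact ⟨k, hk.symm⟩
  choose k hk using hc
  refine ⟨(equivFinsuppOfBasisLeft β z).sum fun i _ => k i • β i, ?_⟩
  conv_lhs => rw [← (equivFinsuppOfBasisLeft β).symm_apply_apply z,
    equivFinsuppOfBasisLeft_symm_apply]
  rw [Finsupp.sum, Finsupp.sum, map_sum]
  refine Finset.sum_congr rfl fun i _ => ?_
  rw [hk, Algebra.TensorProduct.algebraMap_apply, Algebra.algebraMap_eq_smul_one,
    TensorProduct.tmul_smul, TensorProduct.smul_tmul']
  simp

instance isCentral_tensorProduct [Algebra.IsCentral K B] : Algebra.IsCentral L (L ⊗[K] B) where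
  out z hz := by
    obtain ⟨l, hl⟩ := exists_eq_algebraMap_of_commute z
      fun b => Subalgebra.mem_center_iff.mp hz (1 ⊗ₜ b)
    exact Algebra.mem_bot.mpr ⟨l, hl.symm⟩

/-- Minimal-support argument: in a nonzero ideal take `z` with fewest nonzero coordinates.
Simplicity of `B` replaces it by some `w` with one coordinate equal to 1 and no larger support.
Commutators of `w` with `1 ⊗ b` lose that coordinate, hence vanish, so `w` is a nonzero scalar of
`L`. -/
instance isSimpleRing_tensorProduct [Algebra.IsCentral K B] [IsSimpleRing B] :
    IsSimpleRing (L ⊗[K] B) := by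
  classical
  set β := Module.Basis.ofVectorSpace K L
  set E := equivFinsuppOfBasisLeft (N := B) β
  refine .of_eq_bot_or_eq_top fun J => or_iff_not_imp_left.mpr fun hJ => ?_
  have hex : ∃ n : ℕ, ∃ z ∈ J, z ≠ 0 ∧ (E z).support.card = n := by
    by_contra hne
    refine hJ (TwoSidedIdeal.ext fun x => ⟨fun hx => ?_, fun hx => ?_⟩)
    · by_contra hx0
      exact hne ⟨_, x, hx, fun h => hx0 (h ▸ TwoSidedIdeal.zero_mem _), rfl⟩
    · rw [TwoSidedIdeal.mem_bot] at hx
      exact hx ▸ TwoSidedIdeal.zero_mem _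
  obtain ⟨z, hzJ, hz0, hzn⟩ := Nat.find_spec hex
  have hmin : ∀ w ∈ J, (E w).support.card < (E z).support.card → w = 0 := by
    intro w hw hlt
    by_contra hw0
    exact Nat.find_min hex (hzn ▸ hlt) ⟨w, hw, hw0, rfl⟩
  obtain ⟨i, hi⟩ : ∃ i, E z i ≠ 0 := by
    by_contra! hne
    exact hz0 (E.injective (by ext i; simpa using hne i))
  -- The `i`-th coordinates of the elements of `J` supported inside the support of `z` form a
  -- two-sided ideal of `B`, nonzero because of `z`.
  let J' : TwoSidedIdeal B := TwoSidedIdeal.mk'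
    {b | ∃ w ∈ J, (E w).support ⊆ (E z).support ∧ E w i = b}
    ⟨0, J.zero_mem, by simp, by simp⟩
    (by
      rintro x y ⟨w, hw, hws, rfl⟩ ⟨w', hw', hws', rfl⟩
      refine ⟨w + w', J.add_mem hw hw', ?_, by simp⟩
      rw [map_add]
      exact Finsupp.support_add.trans (Finset.union_subset hws hws'))
    (by
      rintro x ⟨w, hw, hws, rfl⟩
      exact ⟨-w, J.neg_mem hw, by simpa [Finsupp.support_neg] using hws, by simp⟩)
    (by
      rintro x y ⟨w, hw, hws, rfl⟩
      have hE : ∀ j, E ((1 ⊗ₜ x) * w) j = x * E w j := fun j => by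
        simpa [← Algebra.TensorProduct.one_def] using equivFinsuppOfBasisLeft_mul_mul β x 1 w j
      refine ⟨(1 ⊗ₜ x) * w, J.mul_mem_left _ _ hw, fun j hj => hws ?_, hE i⟩
      rw [Finsupp.mem_support_iff, hE] at hj
      exact Finsupp.mem_support_iff.mpr (right_ne_zero_of_mul hj))
    (by
      rintro x y ⟨w, hw, hws, rfl⟩
      have hE : ∀ j, E (w * (1 ⊗ₜ y)) j = E w j * y := fun j => by
        simpa [← Algebra.TensorProduct.one_def] using equivFinsuppOfBasisLeft_mul_mul β 1 y w j
      refine ⟨w * (1 ⊗ₜ y), J.mul_mem_right _ _ hw, fun j hj => hws ?_, hE i⟩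
      rw [Finsupp.mem_support_iff, hE] at hj
      exact Finsupp.mem_support_iff.mpr (left_ne_zero_of_mul hj))
  have hone : (1 : B) ∈ J' := IsSimpleRing.one_mem_of_ne_zero_mem J' hi
    ((TwoSidedIdeal.mem_mk' ..).mpr ⟨z, hzJ, subset_rfl, rfl⟩)
  obtain ⟨w, hw, hws, hw1⟩ := (TwoSidedIdeal.mem_mk' ..).mp hone
  have hcomm : ∀ b : B, (1 ⊗ₜ b) * w = w * (1 ⊗ₜ b) := by
    intro b
    have h1 : ∀ j, E ((1 ⊗ₜ b) * w) j = b * E w j := fun j => by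
      simpa [← Algebra.TensorProduct.one_def] using equivFinsuppOfBasisLeft_mul_mul β b 1 w j
    have h2 : ∀ j, E (w * (1 ⊗ₜ b)) j = E w j * b := fun j => by
      simpa [← Algebra.TensorProduct.one_def] using equivFinsuppOfBasisLeft_mul_mul β 1 b w j
    refine sub_eq_zero.mp (hmin _ (J.sub_mem (J.mul_mem_left _ _ hw) (J.mul_mem_right _ _ hw)) ?_)
    refine Finset.card_lt_card ((Finset.ssubset_iff_of_subset fun j hj => ?_).mpr
      ⟨i, Finsupp.mem_support_iff.mpr hi, ?_⟩)
    · refine hws (Finsupp.mem_support_iff.mpr fun h0 => Finsupp.mem_support_iff.mp hj ?_)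
      rw [map_sub, Finsupp.sub_apply, h1, h2, h0, mul_zero, zero_mul, sub_zero]
    · rw [Finsupp.mem_support_iff, not_not, map_sub, Finsupp.sub_apply, h1, h2, hw1]
      simp
  obtain ⟨l, hl⟩ := exists_eq_algebraMap_of_commute w hcomm
  have hl0 : l ≠ 0 := by
    rintro rfl
    rw [map_zero] at hl
    rw [hl, map_zero, Finsupp.zero_apply] at hw1
    exact zero_ne_one hw1
  rw [← TwoSidedIdeal.one_mem_iff]
  have := J.mul_mem_left (algebraMap L _ l⁻¹) _ hw
  rwa [hl, ← map_mul, inv_mul_cancel₀ hl0, map_one] at this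

end BaseChange

/-! ### Quaternion algebras -/

section Quaternion

variable {F D : Type*} [Field F] [Ring D] [Algebra F D]

/-- `F[z]` is a field whose degree divides 4. Degree 4 would make `D` commutative, against
centrality, so the degree is at most 2 and `1, z, z ^ 2` are dependent. -/
lemma exists_sq_eq_of_isDomain [IsDomain D] [Algebra.IsCentral F D]
    (hdim : Module.finrank F D = 4) (z : D) : ∃ t n : F, z ^ 2 = t • z - n • (1 : D) := by
  have : FiniteDimensional F D := Module.finite_of_finrank_pos (by omega)
  let S := Algebra.adjoin F {z}
  have hmul : Module.finrank F S * Module.finrank S D = 4 := by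
    let _ : DivisionRing S := divisionRingOfFiniteDimensional F S
    exact (Module.finrank_mul_finrank F S D).trans hdim
  have hS4 : Module.finrank F S ≠ 4 := by
    intro h4
    have htop : S = ⊤ := Subalgebra.toSubmodule_injective
      (Submodule.eq_top_of_finrank_eq (h4.trans hdim.symm))
    have hcomm : IsMulCommutative S := Algebra.isMulCommutative_adjoin F (by simp)
    have hcenter : (⊥ : Subalgebra F D) = ⊤ := by
      refine top_le_iff.mp fun x _ => Algebra.IsCentral.out (Subalgebra.mem_center_iff.mpr ?_)
      intro y
      have hx : x ∈ S := htop ▸ Algebra.mem_top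
      have hy : y ∈ S := htop ▸ Algebra.mem_top
      exact congrArg Subtype.val (hcomm.is_comm.comm ⟨y, hy⟩ ⟨x, hx⟩)
    have := Subalgebra.bot_eq_top_iff_finrank_eq_one.mp hcenter
    omega
  have hS2 : Module.finrank F S ≤ 2 := by
    have hd : Module.finrank F S ∣ 4 := ⟨_, hmul.symm⟩
    have hle := Nat.le_of_dvd (by norm_num) hd
    interval_cases h : Module.finrank F S <;> omega
  have hz : z ∈ S := Algebra.self_mem_adjoin_singleton F z
  have hdep : ¬ LinearIndependent F ![(1 : S), ⟨z, hz⟩, ⟨z, hz⟩ ^ 2] := by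
    intro hli
    have := hli.fintype_card_le_finrank
    simp only [Fintype.card_fin] at this
    omega
  obtain ⟨g, hg, i, hi⟩ := Fintype.not_linearIndependent_iff.mp hdep
  replace hg : g 0 • (1 : D) + g 1 • z + g 2 • z ^ 2 = 0 := by
    simpa [Fin.sum_univ_three] using congrArg S.val hg
  by_cases h2 : g 2 = 0
  · have h1 : g 1 ≠ 0 := by
      intro h1
      have h0 : g 0 = 0 := by simpa [h1, h2] using hg
      fin_cases i <;> simp_all
    have hz' : z = (-(g 1)⁻¹ * g 0) • (1 : D) := by
      rw [h2, zero_smul, add_zero] at hg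
      rw [mul_smul, neg_smul, eq_neg_of_add_eq_zero_left hg, smul_neg, neg_neg, smul_smul,
        inv_mul_cancel₀ h1, one_smul]
    refine ⟨-(g 1)⁻¹ * g 0, 0, ?_⟩
    nth_rw 1 [pow_two, hz']
    simp
  · refine ⟨-(g 2)⁻¹ * g 1, (g 2)⁻¹ * g 0, ?_⟩
    have : z ^ 2 = (g 2)⁻¹ • g 2 • z ^ 2 := by rw [smul_smul, inv_mul_cancel₀ h2, one_smul]
    rw [this, eq_neg_of_add_eq_zero_right hg]
    module

/-- By Wedderburn `D` is a matrix ring `M_n(E)` with `n ^ 2 [E : F] = 4`. Either `n = 1` and `D` is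
a domain, or `n = 2`, `E = F`, and the equation is Cayley–Hamilton. -/
lemma exists_sq_eq [Algebra.IsCentral F D] [IsSimpleRing D] (hdim : Module.finrank F D = 4)
    (z : D) : ∃ t n : F, z ^ 2 = t • z - n • (1 : D) := by
  have : FiniteDimensional F D := Module.finite_of_finrank_pos (by omega)
  have : IsArtinianRing D := IsArtinianRing.of_finite F D
  obtain ⟨n, hn, E, _, _, _, ⟨φ⟩⟩ := IsSimpleRing.exists_algEquiv_matrix_divisionRing_finite F D
  have hcard : n * n * Module.finrank F E = 4 := by
    rw [← hdim, φ.toLinearEquiv.finrank_eq, Module.finrank_matrix, Fintype.card_fin]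
  have hn2 : n = 1 ∨ n = 2 := by
    have hE : 0 < Module.finrank F E := Module.finrank_pos
    have h0 := hn.out
    have : n ≤ 2 := by nlinarith
    omega
  obtain rfl | rfl := hn2
  · have : IsDomain D := by
      have : Nontrivial D := φ.toEquiv.nontrivial
      have : NoZeroDivisors D := ⟨fun {a b} hab => by
        have h : (φ a) 0 0 * (φ b) 0 0 = 0 := by
          simpa [Matrix.mul_apply] using congr((φ $hab) 0 0)
        refine (mul_eq_zero.mp h).imp (fun h => φ.injective ?_) (fun h => φ.injective ?_) <;>
        · ext i j
          rw [Subsingleton.elim i 0, Subsingleton.elim j 0, h, map_zero, Matrix.zero_apply]⟩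
      exact NoZeroDivisors.to_isDomain D
    exact exists_sq_eq_of_isDomain hdim z
  · have hE1 : Module.finrank F E = 1 := by omega
    have hsurj : ∀ x : E, ∃ a : F, algebraMap F E a = x := fun x =>
      Algebra.mem_bot.mp ((Subalgebra.bot_eq_top_of_finrank_eq_one hE1).symm ▸ Algebra.mem_top)
    choose g hg using hsurj
    set M : Matrix (Fin 2) (Fin 2) F := (φ z).map g with hM
    have hMz : ∀ i j, algebraMap F E (M i j) = φ z i j := fun i j => hg _
    refine ⟨M 0 0 + M 1 1, M 0 0 * M 1 1 - M 0 1 * M 1 0, φ.injective ?_⟩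
    have key : M ^ 2 = (M 0 0 + M 1 1) • M - (M 0 0 * M 1 1 - M 0 1 * M 1 0) • 1 := by
      ext i j
      fin_cases i <;> fin_cases j <;> simp [pow_two, Matrix.mul_apply, Fin.sum_univ_two] <;> ring
    have hφ : φ z = (algebraMap F E).mapMatrix M := by
      ext i j
      exact (hMz i j).symm
    rw [map_pow, map_sub, map_smul, map_smul, map_one, hφ, ← map_pow, key]
    ext i j
    simp only [RingHom.mapMatrix_apply, Matrix.map_apply, Matrix.sub_apply, Matrix.smul_apply,
      smul_eq_mul, map_sub, map_mul (algebraMap F E) _ (M i j)]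
    rw [map_mul (algebraMap F E) _ ((1 : Matrix (Fin 2) (Fin 2) F) i j), ← Algebra.smul_def,
      ← Algebra.smul_def, Matrix.one_apply, Matrix.one_apply]
    split_ifs <;> simp

/-- `D x D` meets every Peirce component. -/
lemma exists_mul_mul_ne_zero [IsSimpleRing D] {a b : D} (ha : a ≠ 0) (hb : b ≠ 0) :
    ∃ z, a * z * b ≠ 0 := by
  by_contra! h
  let J : TwoSidedIdeal D := TwoSidedIdeal.mk' {x | ∀ z, x * z * b = 0} (by simp)
    (fun {x y} hx hy z => by rw [add_mul, add_mul, hx, hy, add_zero])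
    (fun {x} hx z => by rw [neg_mul, neg_mul, hx, neg_zero])
    (fun {x y} hy z => by rw [mul_assoc, mul_assoc, ← mul_assoc y, hy, mul_zero])
    (fun {x y} hx z => by rw [mul_assoc x, hx])
  have h1 : (1 : D) ∈ J := IsSimpleRing.one_mem_of_ne_zero_mem J ha
    ((TwoSidedIdeal.mem_mk' ..).mpr h)
  exact hb (by simpa using (TwoSidedIdeal.mem_mk' ..).mp h1 1)

/-- The Peirce decomposition of a quaternion algebra at a nontrivial idempotent. -/
lemma exists_peirce [IsSimpleRing D] (hdim : Module.finrank F D = 4) {e f : D}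
    (hef : e + f = 1) (hee : e * e = e) (he0 : e ≠ 0) (hf0 : f ≠ 0) :
    ∃ u v : D, ∀ z, (∃ a : F, e * z * e = a • e) ∧ (∃ a : F, f * z * f = a • f) ∧
      (∃ a : F, e * z * f = a • u) ∧ (∃ a : F, f * z * e = a • v) := by
  obtain rfl : f = 1 - e := eq_sub_of_add_eq' hef
  set f := 1 - e with hf
  have hef0 : e * f = 0 := by rw [hf, mul_sub, mul_one, hee, sub_self]
  have hfe0 : f * e = 0 := by rw [hf, sub_mul, one_mul, hee, sub_self]
  have hff : f * f = f := by rw [hf, mul_sub, ← hf, hfe0, mul_one, sub_zero]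
  obtain ⟨z, hz⟩ := exists_mul_mul_ne_zero he0 hf0
  obtain ⟨w, hw⟩ := exists_mul_mul_ne_zero hf0 he0
  set u := e * z * f with hu
  set v := f * w * e with hv
  have heu : e * u = u := by rw [hu, ← mul_assoc, ← mul_assoc, hee]
  have hfu : f * u = 0 := by rw [hu, ← mul_assoc, ← mul_assoc, hfe0, zero_mul, zero_mul]
  have huf : u * f = u := by rw [hu, mul_assoc, hff]
  have hue : u * e = 0 := by rw [hu, mul_assoc, hfe0, mul_zero]
  have hfv : f * v = v := by rw [hv, ← mul_assoc, ← mul_assoc, hff]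
  have hev : e * v = 0 := by rw [hv, ← mul_assoc, ← mul_assoc, hef0, zero_mul, zero_mul]
  have hve : v * e = v := by rw [hv, mul_assoc, hee]
  have hvf : v * f = 0 := by rw [hv, mul_assoc, hef0, mul_zero]
  -- The four elements lie in the four different Peirce components, so multiplying a relation by `e`
  -- or `f` on each side isolates one term. Having four elements, the family is a basis.
  have hli : LinearIndependent F ![e, f, u, v] := by
    rw [Fintype.linearIndependent_iff]
    intro g hg
    simp only [Fin.sum_univ_four, Matrix.cons_val] at hg
    have h0 : g 0 • e = 0 := by
      simpa [mul_add, add_mul, hee, hef0, heu, hev, hfe0, hue] using congr(e * $hg * e)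
    have h1 : g 1 • f = 0 := by
      simpa [mul_add, add_mul, hff, hfe0, hfu, hfv, hef0, hvf] using congr(f * $hg * f)
    have h2 : g 2 • u = 0 := by
      simpa [mul_add, add_mul, hee, hef0, heu, hev, hfe0, huf] using congr(e * $hg * f)
    have h3 : g 3 • v = 0 := by
      simpa [mul_add, add_mul, hff, hfe0, hfu, hfv, hef0, hve] using congr(f * $hg * e)
    intro i
    fin_cases i
    · exact (smul_eq_zero.mp h0).resolve_right he0
    · exact (smul_eq_zero.mp h1).resolve_right hf0
    · exact (smul_eq_zero.mp h2).resolve_right hz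
    · exact (smul_eq_zero.mp h3).resolve_right hw
  have : FiniteDimensional F D := Module.finite_of_finrank_pos (by omega)
  have hspan := hli.span_eq_top_of_card_eq_finrank' (by simp [hdim])
  refine ⟨u, v, fun x => ?_⟩
  have hx : x ∈ Submodule.span F (Set.range ![e, f, u, v]) := hspan ▸ Submodule.mem_top
  obtain ⟨g, rfl⟩ := (Submodule.mem_span_range_iff_exists_fun F).mp hx
  simp only [Fin.sum_univ_four, Matrix.cons_val]
  refine ⟨⟨g 0, ?_⟩, ⟨g 1, ?_⟩, ⟨g 2, ?_⟩, ⟨g 3, ?_⟩⟩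
  · simp [mul_add, add_mul, hee, hef0, heu, hev, hue]
  · simp [mul_add, add_mul, hff, hfe0, hfu, hfv, hvf]
  · simp [mul_add, add_mul, hee, hef0, heu, hev, huf]
  · simp [mul_add, add_mul, hff, hfe0, hfu, hfv, hve]

end Quaternion

/-! ### Invertible lattices -/

section General

variable {R K B : Type*} [CommRing R] [Field K] [Algebra R K] [Ring B]
  [Algebra K B] [Algebra R B] [IsScalarTower R K B]

lemma mul_latticeInv_le (Λ : Submodule R B) :
    Λ * latticeInv Λ ≤ Subalgebra.toSubmodule (leftOrder Λ) :=
  Submodule.mul_le.mpr fun a ha _ hx b hb => hx a ha b hb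

lemma latticeInv_mul_le (Λ : Submodule R B) :
    latticeInv Λ * Λ ≤ Subalgebra.toSubmodule (rightOrder Λ) :=
  Submodule.mul_le.mpr fun x hx b hb a ha => by
    rw [← mul_assoc]
    exact hx a ha b hb

lemma mul_mem_latticeInv {Λ : Submodule R B} {x y : B} (hx : x ∈ latticeInv Λ)
    (hy : y ∈ leftOrder Λ) : x * y ∈ latticeInv Λ := fun a ha b hb => by
  rw [← mul_assoc, mul_assoc]
  exact hx a ha _ (hy b hb)

/-- Invertibility follows from any `Λ'` that behaves like an inverse. If `x Λ ⊆ Λ`, then `x`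
preserves `Λ Λ' = O`, which contains 1. Moreover `Λ' ⊆ Λ⁻¹`, and `Λ⁻¹ Λ` contains 1 and is stable
under right multiplication by the right order. -/
lemma mem_leftIdeals_of_mul_eq {O : Subalgebra R B} {Λ Λ' : Submodule R B}
    (hΛ : Submodule.IsLattice K Λ) (h1 : Λ * Λ' = Subalgebra.toSubmodule O)
    (h2 : ∀ x ∈ O, ∀ y ∈ Λ, x * y ∈ Λ) (h3 : (1 : B) ∈ Λ' * Λ) : Λ ∈ leftIdeals K O := by
  have hleft : leftOrder Λ = O := by
    refine le_antisymm (fun x hx => ?_) h2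
    have h : ∀ y ∈ Λ * Λ', x * y ∈ Λ * Λ' := by
      intro y hy
      refine Submodule.mul_induction_on hy (fun a ha b hb => ?_) fun a b ha hb => ?_
      · rw [← mul_assoc]
        exact Submodule.mul_mem_mul (hx a ha) hb
      · rw [mul_add]
        exact add_mem ha hb
    rw [h1] at h
    simpa using h 1 O.one_mem
  have hΛ' : Λ' ≤ latticeInv Λ := fun x hx a ha b hb =>
    h2 _ (h1.le (Submodule.mul_mem_mul ha hx)) b hb
  refine ⟨⟨hΛ, le_antisymm (mul_latticeInv_le Λ) ?_, le_antisymm (latticeInv_mul_le Λ) ?_⟩, hleft⟩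
  · rw [hleft, ← h1]
    exact mul_le_mul_right hΛ' Λ
  · intro x hx
    have h : ∀ y ∈ latticeInv Λ * Λ, y * x ∈ latticeInv Λ * Λ := by
      intro y hy
      refine Submodule.mul_induction_on hy (fun a ha b hb => ?_) fun a b ha hb => ?_
      · rw [mul_assoc]
        exact Submodule.mul_mem_mul ha (hx b hb)
      · rw [add_mul]
        exact add_mem ha hb
    simpa using h 1 (mul_le_mul_left hΛ' Λ h3)

lemma mul_mem_of_mem_leftIdeals {O : Subalgebra R B} {Λ : Submodule R B}
    (hΛ : Λ ∈ leftIdeals K O) {x y : B} (hx : x ∈ O) (hy : y ∈ Λ) : x * y ∈ Λ := by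
  rw [← hΛ.2] at hx
  exact hx y hy

lemma mul_latticeInv_eq {O : Subalgebra R B} {Λ : Submodule R B} (hΛ : Λ ∈ leftIdeals K O) :
    Λ * latticeInv Λ = Subalgebra.toSubmodule O := by
  rw [hΛ.1.mul_inv, hΛ.2]

lemma one_mem_latticeInv_mul {O : Subalgebra R B} {Λ : Submodule R B} (hΛ : Λ ∈ leftIdeals K O) :
    (1 : B) ∈ latticeInv Λ * Λ := by
  rw [hΛ.1.inv_mul]
  exact (rightOrder Λ).one_mem

lemma mem_rightTranslate {Λ : Submodule R B} {x z : B} :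
    z ∈ rightTranslate Λ x ↔ ∃ w ∈ Λ, w * x = z := Iff.rfl

lemma mem_rightTranslate_units {Λ : Submodule R B} {x : Bˣ} {z : B} :
    z ∈ rightTranslate Λ (x : B) ↔ z * ((x⁻¹ : Bˣ) : B) ∈ Λ := by
  rw [mem_rightTranslate]
  constructor
  · rintro ⟨w, hw, rfl⟩
    simpa using hw
  · exact fun h => ⟨_, h, by simp⟩

/-- Since `Λ` spans `B`, so does `B X`; thus `X` has a left inverse, which is two-sided by finite
dimension. -/
lemma exists_units_of_eq_rightTranslate [FiniteDimensional K B] {O : Subalgebra R B}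
    {Λ : Submodule R B} (hΛ : Submodule.IsLattice K Λ) {X : B}
    (h : Λ = rightTranslate (Subalgebra.toSubmodule O) X) :
    ∃ x : Bˣ, Λ = rightTranslate (Subalgebra.toSubmodule O) (x : B) := by
  have : IsNoetherianRing B := IsNoetherianRing.of_finite K B
  have hle : Submodule.span K (Λ : Set B) ≤ LinearMap.range (LinearMap.mulRight K X) := by
    rw [Submodule.span_le, h]
    rintro _ ⟨w, -, rfl⟩
    exact ⟨w, rfl⟩
  rw [hΛ.span_eq_top] at hle
  obtain ⟨w, hw⟩ := hle (Submodule.mem_top (x := 1))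
  replace hw : w * X = 1 := hw
  exact ⟨⟨X, w, mul_eq_one_comm.mp hw, hw⟩, h⟩

/-- `Λ = Λ Y X ⊆ Λ Λ⁻¹ X = O X ⊆ Λ`. -/
lemma exists_units_of_mul_eq_one [FiniteDimensional K B] {O : Subalgebra R B}
    {Λ : Submodule R B} (hΛ : Λ ∈ leftIdeals K O) {X Y : B} (hX : X ∈ Λ) (hY : Y ∈ latticeInv Λ)
    (hXY : X * Y = 1) : ∃ x : Bˣ, Λ = rightTranslate (Subalgebra.toSubmodule O) (x : B) := by
  have : IsNoetherianRing B := IsNoetherianRing.of_finite K B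
  refine exists_units_of_eq_rightTranslate hΛ.1.isLattice (X := X) (le_antisymm ?_ ?_)
  · refine fun z hz => mem_rightTranslate.mpr ⟨z * Y, ?_, ?_⟩
    · rw [← mul_latticeInv_eq hΛ]
      exact Submodule.mul_mem_mul hz hY
    · rw [mul_assoc, mul_eq_one_comm.mp hXY, mul_one]
  · rintro _ ⟨w, hw, rfl⟩
    exact mul_mem_of_mem_leftIdeals hΛ hw hX

end General

/-! ### Invertible lattices over a henselian discrete valuation ring are principal -/

section Local

open Polynomial

variable {A F D : Type*} [CommRing A] [Field F] [Algebra A F] [IsFractionRing A F]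
  [Ring D] [Algebra F D] [Algebra A D] [IsScalarTower A F D]

/-- If `z` is not a scalar, the quadratic is its minimal polynomial over `F`. It divides a monic
polynomial over the integrally closed `A`, so its coefficients lie in `A`. If `z` is a scalar `a`,
then `a` is in `A` and `(X - a) ^ 2` serves. -/
lemma exists_sq_eq_of_isIntegral [IsIntegrallyClosed A] [Nontrivial D] {z : D}
    (hz : IsIntegral A z) (hsq : ∃ t n : F, z ^ 2 = t • z - n • (1 : D)) :
    ∃ t n : A, z ^ 2 = t • z - n • (1 : D) := by
  have hinj : Function.Injective (algebraMap F D) := FaithfulSMul.algebraMap_injective F D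
  obtain ⟨t, n, htn⟩ := hsq
  by_cases hF : ∃ a : F, algebraMap F D a = z
  · obtain ⟨a, rfl⟩ := hF
    obtain ⟨a, rfl⟩ := IsIntegrallyClosed.isIntegral_iff.mp ((isIntegral_algebraMap_iff hinj).mp hz)
    refine ⟨a + a, a * a, ?_⟩
    rw [← IsScalarTower.algebraMap_apply, ← Algebra.algebraMap_eq_smul_one, Algebra.smul_def,
      ← map_pow, ← map_mul, ← map_sub]
    congr 1
    ring
  · have hzF : IsIntegral F z := hz.tower_top
    set P : F[X] := X ^ 2 - C t * X + C n with hP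
    have hPdeg : P.natDegree = 2 := by rw [hP]; compute_degree!
    have hPm : P.Monic := by rw [hP]; monicity!
    have hP0 : aeval z P = 0 := by
      simp only [hP, map_add, map_sub, map_mul, map_pow, aeval_X, aeval_C, htn,
        Algebra.algebraMap_eq_smul_one, smul_mul_assoc, one_mul]
      abel
    have hdeg : 2 ≤ (minpoly F z).natDegree := by
      by_contra! hlt
      have h1 := minpoly.natDegree_pos hzF
      have : (minpoly F z).degree = 1 := by
        exact (degree_eq_iff_natDegree_eq_of_pos one_pos).mpr (by omega)
      exact hF (minpoly.mem_range_of_degree_eq_one F z this)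
    have hmin : minpoly F z = P := (eq_of_monic_of_dvd_of_natDegree_le (minpoly.monic hzF) hPm
      (minpoly.dvd F z hP0) (by omega)).symm
    obtain ⟨Q, hQm, hQ0⟩ := hz
    have hdvd : P ∣ Q.map (algebraMap A F) := by
      rw [← hmin]
      refine minpoly.dvd F z ?_
      rw [aeval_map_algebraMap]
      exact hQ0
    obtain ⟨G, hG⟩ := IsIntegrallyClosed.eq_map_mul_C_of_dvd F hQm hdvd
    rw [hPm.leadingCoeff, map_one, mul_one] at hG
    refine ⟨-G.coeff 1, G.coeff 0, ?_⟩
    have h1 : algebraMap A F (-G.coeff 1) = t := by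
      have := congr(($hG).coeff 1)
      simp [hP, coeff_C] at this
      simp [this]
    have h0 : algebraMap A F (G.coeff 0) = n := by
      have := congr(($hG).coeff 0)
      simpa [hP, coeff_X, coeff_C] using this
    rw [htn, ← h1, ← h0, algebraMap_smul, algebraMap_smul]

open IsLocalRing in
/-- In a henselian local ring, `X ^ 2 - t X + n` with `n` and `1 - t + n` nonunits has roots
congruent to `0` and `1`. -/
lemma exists_roots_of_henselian [HenselianLocalRing A] {t n : A} (hn : ¬ IsUnit n)
    (htn : ¬ IsUnit (1 - t + n)) : ∃ a b : A, a + b = t ∧ a * b = n ∧ IsUnit (b - a) := by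
  rw [← mem_nonunits_iff, ← mem_maximalIdeal] at hn htn
  have ht1 : 1 - t ∈ maximalIdeal A := by simpa using sub_mem htn hn
  have ht : IsUnit t := by
    by_contra ht
    rw [← mem_nonunits_iff, ← mem_maximalIdeal] at ht
    exact (Ideal.ne_top_iff_one _).mp (maximalIdeal.isMaximal A).ne_top
      (by simpa using add_mem ht1 ht)
  -- At 0 the polynomial has value `n`, a nonunit, and derivative `-t`, a unit because `1 - t` lies
  -- in the maximal ideal. The other root is `t - a`.
  obtain ⟨a, ha, ha0⟩ := HenselianLocalRing.is_henselian (X ^ 2 - C t * X + C n) (by monicity!) 0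
    (by simpa using hn) (by simpa using ht)
  rw [sub_zero] at ha0
  have ha' : a ^ 2 - t * a + n = 0 := by simpa using ha
  refine ⟨a, t - a, by ring, by linear_combination -ha', ?_⟩
  by_contra hu
  rw [← mem_nonunits_iff, ← mem_maximalIdeal] at hu
  refine (mem_maximalIdeal t).mp ?_ ht
  have := add_mem hu (add_mem ha0 ha0)
  ring_nf at this
  exact this

/-- An element `z` of an order over a henselian ring such that neither `z` nor `1 - z` is a unit
produces a nontrivial idempotent. -/
lemma exists_inverse_or_idempotent [HenselianLocalRing A] [IsIntegrallyClosed A]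
    [Algebra.IsCentral F D] [IsSimpleRing D] (hdim : Module.finrank F D = 4)
    {O : Subalgebra A D} (hO : IsOrder F O) {z : D} (hz : z ∈ O) :
    (∃ w ∈ O, z * w = 1) ∨ (∃ w ∈ O, (1 - z) * w = 1) ∨
      ∃ e ∈ O, e * e = e ∧ e ≠ 0 ∧ e ≠ 1 := by
  have hint : IsIntegral A z := IsIntegral.of_mem_of_fg O hO.fg z hz
  obtain ⟨t, n, h⟩ := exists_sq_eq_of_isIntegral hint (exists_sq_eq (F := F) hdim z)
  rw [pow_two] at h
  -- `n = z (t - z)` and `1 - t + n = (1 - z) (1 - t + z)` are the norms of `z` and `1 - z`; a unit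
  -- norm gives an explicit inverse.
  by_cases hn : IsUnit n
  · obtain ⟨n, rfl⟩ := hn
    left
    refine ⟨(↑n⁻¹ : A) • (t • 1 - z),
      O.smul_mem (sub_mem (O.smul_mem O.one_mem _) hz) _, ?_⟩
    rw [mul_smul_comm, mul_sub, h, mul_smul_comm, mul_one, sub_sub_cancel, smul_smul,
      Units.inv_mul, one_smul]
  by_cases hn' : IsUnit (1 - t + n)
  · obtain ⟨d, hd⟩ := hn'
    right; left
    refine ⟨(↑d⁻¹ : A) • ((1 - t) • 1 + z),
      O.smul_mem (add_mem (O.smul_mem O.one_mem _) hz) _, ?_⟩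
    have : (1 - z) * ((1 - t) • 1 + z) = (d : A) • 1 := by
      simp only [hd, mul_add, sub_mul, h, mul_smul_comm, mul_one, one_mul]
      module
    rw [mul_smul_comm, this, smul_smul, Units.inv_mul, one_smul]
  -- Now `(z - a) (z - b) = 0` with `d = b - a` a unit, so `(z - a) / d` is idempotent. It is
  -- trivial only if `z` is the scalar `a` or `b`, and then locality of `A` decides.
  obtain ⟨a, b, hab, habn, d, hd⟩ := exists_roots_of_henselian hn hn'
  have hsq : (z - a • 1) * (z - a • 1) = (d : A) • (z - a • 1) := by
    simp only [mul_sub, sub_mul, h, mul_smul_comm, smul_mul_assoc, mul_one, one_mul]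
    rw [hd, ← hab, ← habn]
    module
  by_cases he0 : z - a • 1 = 0
  · by_cases ha : IsUnit a
    · obtain ⟨a, rfl⟩ := ha
      exact Or.inl ⟨(↑a⁻¹ : A) • 1, O.smul_mem O.one_mem _, by
        rw [sub_eq_zero.mp he0, smul_mul_smul_comm, mul_one, Units.mul_inv, one_smul]⟩
    · obtain ⟨c, hc⟩ := (IsLocalRing.isUnit_or_isUnit_one_sub_self a).resolve_left ha
      refine Or.inr (Or.inl ⟨(↑c⁻¹ : A) • 1, O.smul_mem O.one_mem _, ?_⟩)
      have : (1 : D) - z = (c : A) • 1 := by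
        rw [hc, sub_eq_zero.mp he0]
        module
      rw [this, smul_mul_smul_comm, mul_one, Units.mul_inv, one_smul]
  by_cases he1 : z - a • 1 = (d : A) • 1
  · have hzb : z = b • 1 := by
      rw [sub_eq_iff_eq_add.mp he1, hd]
      module
    by_cases hb : IsUnit b
    · obtain ⟨b, rfl⟩ := hb
      exact Or.inl ⟨(↑b⁻¹ : A) • 1, O.smul_mem O.one_mem _, by
        rw [hzb, smul_mul_smul_comm, mul_one, Units.mul_inv, one_smul]⟩
    · obtain ⟨c, hc⟩ := (IsLocalRing.isUnit_or_isUnit_one_sub_self b).resolve_left hb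
      refine Or.inr (Or.inl ⟨(↑c⁻¹ : A) • 1, O.smul_mem O.one_mem _, ?_⟩)
      have : (1 : D) - z = (c : A) • 1 := by
        rw [hc, hzb]
        module
      rw [this, smul_mul_smul_comm, mul_one, Units.mul_inv, one_smul]
  refine Or.inr (Or.inr ⟨(↑d⁻¹ : A) • (z - a • 1),
    O.smul_mem (sub_mem hz (O.smul_mem O.one_mem _)) _, ?_, ?_, ?_⟩)
  · rw [smul_mul_smul_comm, hsq, smul_smul, mul_assoc, Units.inv_mul, mul_one]
  · intro h0
    apply he0
    have := congr((d : A) • $h0)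
    rwa [smul_smul, Units.mul_inv, one_smul, smul_zero] at this
  · intro h1
    apply he1
    have := congr((d : A) • $h1)
    rwa [smul_smul, Units.mul_inv, one_smul] at this

/-- If a sum of products `x y` with `x ∈ Λ`, `y ∈ Λ'` has a property which passes from a sum to one
of its terms, then a product has it. -/
lemma exists_mul_of_mem_mul {Λ Λ' : Submodule A D} (P : D → Prop)
    (hP : ∀ a ∈ Λ * Λ', ∀ b ∈ Λ * Λ', P (a + b) → P a ∨ P b) {z : D} (hz : z ∈ Λ * Λ') (hPz : P z) :
    ∃ x ∈ Λ, ∃ y ∈ Λ', P (x * y) := by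
  revert hPz
  induction hz using Submodule.mul_induction_on' with
  | mem_mul_mem m hm n hn => exact fun h => ⟨m, hm, n, hn, h⟩
  | add x hx y hy ihx ihy => exact fun h => (hP x hx y hy h).elim ihx ihy

/-- Without nontrivial idempotents `O` behaves as a local ring: of two elements with right
invertible sum, one is right invertible. Applied to `1 ∈ Λ Λ⁻¹`, this produces a right invertible
product of an element of `Λ` and one of `Λ⁻¹`. -/
lemma exists_units_of_forall_idempotent [HenselianLocalRing A] [IsIntegrallyClosed A]
    [Algebra.IsCentral F D] [IsSimpleRing D] (hdim : Module.finrank F D = 4)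
    {O : Subalgebra A D} (hO : IsOrder F O) {Λ : Submodule A D} (hΛ : Λ ∈ leftIdeals F O)
    (hidem : ∀ e ∈ O, e * e = e → e = 0 ∨ e = 1) :
    ∃ x : Dˣ, Λ = rightTranslate (Subalgebra.toSubmodule O) (x : D) := by
  have : FiniteDimensional F D := Module.finite_of_finrank_pos (by omega)
  have hloc : ∀ z ∈ O, (∃ w ∈ O, z * w = 1) ∨ (∃ w ∈ O, (1 - z) * w = 1) := by
    intro z hz
    obtain h | h | ⟨e, he, hee, he0, he1⟩ := exists_inverse_or_idempotent hdim hO hz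
    · exact Or.inl h
    · exact Or.inr h
    · exact ((hidem e he hee).elim he0 he1).elim
  obtain ⟨X, hX, Y, hY, W, hW, h⟩ := exists_mul_of_mem_mul (Λ := Λ) (Λ' := latticeInv Λ)
    (fun z => ∃ w ∈ O, z * w = 1) (by
      rw [mul_latticeInv_eq hΛ]
      rintro a ha b hb ⟨w, hw, hab⟩
      obtain ⟨w', hw', h⟩ | ⟨w', hw', h⟩ := hloc (a * w) (O.mul_mem ha hw)
      · exact Or.inl ⟨w * w', O.mul_mem hw hw', by rw [← mul_assoc, h]⟩
      · refine Or.inr ⟨w * w', O.mul_mem hw hw', ?_⟩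
        rw [← hab, add_mul, add_sub_cancel_left] at h
        rw [← mul_assoc, h, ← add_mul, hab]) (z := 1)
    (by rw [mul_latticeInv_eq hΛ]; exact O.one_mem) ⟨1, O.one_mem, mul_one _⟩
  exact exists_units_of_mul_eq_one hΛ hX
    (mul_mem_latticeInv hY (by rwa [hΛ.2])) (by rw [← mul_assoc, h])

/-- A monic equation for `α • e` becomes one for `α` after multiplication by `e`. It follows that a
corner `e O e` of rank one is just `A e`. -/
lemma exists_mem_of_smul_mem [IsIntegrallyClosed A] {O : Subalgebra A D} (hO : IsOrder F O)
    {e : D} (hee : e * e = e) (he0 : e ≠ 0) {α : F} (hα : α • e ∈ O) :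
    ∃ a : A, algebraMap A F a = α := by
  obtain ⟨p, hp, hp0⟩ := IsIntegral.of_mem_of_fg O hO.fg _ hα
  refine IsIntegrallyClosed.isIntegral_iff.mp ⟨p, hp, ?_⟩
  rw [← aeval_def] at hp0 ⊢
  have hpow : ∀ n : ℕ, (α • e) ^ n * e = α ^ n • e := by
    intro n
    induction n with
    | zero => simp
    | succ n ih => rw [pow_succ', mul_assoc, ih, smul_mul_smul_comm, hee, pow_succ']
  have h : aeval (α • e) p * e = aeval α p • e := by
    simp only [aeval_eq_sum_range, Finset.sum_mul, Finset.sum_smul, smul_mul_assoc, hpow, smul_assoc]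
  rw [hp0, zero_mul, eq_comm] at h
  exact (smul_eq_zero.mp h).resolve_right he0

/-- The corner `e O e = A e` is a local ring. Decomposing `1 ∈ Λ Λ⁻¹` and compressing by `e` on both
sides, some term is a unit multiple of `e`. -/
lemma exists_mul_eq_idempotent [IsLocalRing A] {O : Subalgebra A D}
    {Λ : Submodule A D} (hΛ : Λ ∈ leftIdeals F O) {e : D} (he : e ∈ O) (hee : e * e = e)
    (he0 : e ≠ 0) (hcorner : ∀ z ∈ O, ∃ a : A, e * z * e = a • e) :
    ∃ x ∈ Λ, ∃ y ∈ latticeInv Λ, e * x = x ∧ y * e = y ∧ x * y = e := by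
  obtain ⟨x, hx, y, hy, a, ha⟩ := exists_mul_of_mem_mul (Λ := Λ) (Λ' := latticeInv Λ)
    (fun z => ∃ a : Aˣ, e * z * e = (a : A) • e) (by
      rw [mul_latticeInv_eq hΛ]
      rintro a ha b hb ⟨w, hw⟩
      obtain ⟨α, hα⟩ := hcorner a ha
      obtain ⟨β, hβ⟩ := hcorner b hb
      rw [mul_add, add_mul, hα, hβ, ← add_smul] at hw
      have hinj : α + β = w := by
        rw [← algebraMap_smul F, ← algebraMap_smul F (w : A)] at hw
        exact FaithfulSMul.algebraMap_injective A F (smul_left_injective F he0 hw)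
      obtain ⟨u, rfl⟩ | ⟨u, rfl⟩ := IsLocalRing.isUnit_or_isUnit_of_isUnit_add (hinj ▸ w.isUnit)
      · exact Or.inl ⟨u, hα⟩
      · exact Or.inr ⟨u, hβ⟩) (z := 1)
    (by rw [mul_latticeInv_eq hΛ]; exact O.one_mem) ⟨1, by simpa using hee⟩
  refine ⟨e * x, mul_mem_of_mem_leftIdeals hΛ he hx, (↑a⁻¹ : A) • (y * e),
    Submodule.smul_mem _ _ (mul_mem_latticeInv hy (by rwa [hΛ.2])), ?_, ?_, ?_⟩
  · rw [← mul_assoc, hee]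
  · rw [smul_mul_assoc, mul_assoc, hee]
  · rw [mul_smul_comm, ← mul_assoc, mul_assoc e, ha, smul_smul, Units.inv_mul, one_smul]

/-- A finitely generated submodule of a plane over a principal ideal domain has two generators. -/
lemma exists_two_generators [IsDomain A] [IsPrincipalIdealRing A] {N : Submodule A D} (hN : N.FG) {p q : D}
    (hle : ∀ z ∈ N, z ∈ Submodule.span F {p, q}) :
    ∃ a ∈ N, ∃ b ∈ N, ∀ z ∈ N, ∃ α β : A, z = α • a + β • b := by
  have : Module.Finite A N := Module.Finite.iff_fg.mpr hN
  have : Module.IsTorsionFree A D := Module.IsTorsionFree.trans_faithfulSMul A F D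
  obtain ⟨m, β⟩ := Module.basisOfFiniteTypeTorsionFree' (R := A) (M := N)
  have hli : LinearIndependent F fun i => (β i : D) :=
    (LinearIndependent.iff_fractionRing A F).mp
      (β.linearIndependent.map' N.subtype (Submodule.ker_subtype N))
  have hm : m ≤ 2 := by
    classical
    have h1 : Submodule.span F (Set.range fun i => (β i : D)) ≤ Submodule.span F {p, q} := by
      rw [Submodule.span_le]
      rintro _ ⟨i, rfl⟩
      exact hle _ (β i).2
    have : Module.Finite F (Submodule.span F {p, q}) :=
      Module.Finite.iff_fg.mpr (Submodule.fg_span (by simp))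
    have h2 := Submodule.finrank_mono h1
    rw [finrank_span_eq_card hli, Fintype.card_fin] at h2
    have h3 := finrank_span_finset_le_card (R := F) ({p, q} : Finset D)
    rw [Finset.coe_pair] at h3
    exact h2.trans (h3.trans Finset.card_le_two)
  have hrepr : ∀ z (hz : z ∈ N), z = ∑ i, β.repr ⟨z, hz⟩ i • (β i : D) := fun z hz => by
    have h := congrArg N.subtype (β.sum_repr ⟨z, hz⟩)
    rw [map_sum] at h
    exact h.symm
  match m, β, hm, hrepr with
  | 0, β, _, hrepr => exact ⟨0, N.zero_mem, 0, N.zero_mem, fun z hz => ⟨0, 0, by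
      simpa using hrepr z hz⟩⟩
  | 1, β, _, hrepr => exact ⟨β 0, (β 0).2, 0, N.zero_mem, fun z hz => ⟨β.repr ⟨z, hz⟩ 0, 0, by
      simpa using hrepr z hz⟩⟩
  | 2, β, _, hrepr => exact ⟨β 0, (β 0).2, β 1, (β 1).2, fun z hz =>
      ⟨β.repr ⟨z, hz⟩ 0, β.repr ⟨z, hz⟩ 1, by simpa [Fin.sum_univ_two] using hrepr z hz⟩⟩

/-- An invertible lattice over an order is principal if the order contains a full set of `2 × 2`
matrix units. -/
lemma exists_units_of_matrix_units [IsDomain A] [IsPrincipalIdealRing A] [FiniteDimensional F D]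
    {O : Subalgebra A D} {Λ : Submodule A D} (hΛ : Λ ∈ leftIdeals F O) {e f u v p : D}
    (he : e ∈ O) (hf : f ∈ O) (hu : u ∈ O) (hv : v ∈ O) (hef : e + f = 1) (hee : e * e = e)
    (heu : e * u = u) (hue : u * e = 0) (hve : v * e = v) (hfv : f * v = v)
    (huv : u * v = e) (hvu : v * u = f)
    (hcorner : ∀ z, ∃ a b : F, e * z = a • e + b • p) :
    ∃ x : Dˣ, Λ = rightTranslate (Subalgebra.toSubmodule O) (x : D) := by
  have hmem : ∀ x ∈ O, ∀ y ∈ Λ, x * y ∈ Λ := fun x hx y hy => mul_mem_of_mem_leftIdeals hΛ hx hy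
  have hfe : f * e = 0 := by rw [← hvu, mul_assoc, hue, mul_zero]
  have hev : e * v = 0 := by
    rw [eq_sub_of_add_eq hef, sub_mul, one_mul, hfv, sub_self]
  -- Morita equivalence: `Λ = eΛ + v eΛ`, and `eΛ` has two generators `e a`, `e b`. They become the
  -- two rows of `X = e a + v e b`, from which `e X` and `u X` recover them.
  obtain ⟨a, ⟨a, ha, rfl⟩, b, ⟨b, hb, rfl⟩, hab⟩ := exists_two_generators (F := F)
    (N := Λ.map (LinearMap.mulLeft A e)) (hΛ.1.isLattice.fg.map _) (p := e) (q := p) (by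
      rintro _ ⟨z, -, rfl⟩
      obtain ⟨α, β, h⟩ := hcorner z
      exact Submodule.mem_span_pair.mpr ⟨α, β, h.symm⟩)
  have hab' : ∀ z ∈ Λ, ∃ α β : A, e * z = α • (e * a) + β • (e * b) := fun z hz =>
    hab _ ⟨z, hz, rfl⟩
  have hXe : e * (e * a + v * (e * b)) = e * a := by
    rw [mul_add, ← mul_assoc, hee, ← mul_assoc e v, hev, zero_mul, add_zero]
  have hXu : u * (e * a + v * (e * b)) = e * b := by
    rw [mul_add, ← mul_assoc, hue, zero_mul, zero_add, ← mul_assoc u v, huv, ← mul_assoc, hee]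
  have hXf : f * (e * a + v * (e * b)) = v * (e * b) := by
    rw [mul_add, ← mul_assoc, hfe, zero_mul, zero_add, ← mul_assoc f v, hfv]
  have hXv : v * (e * a + v * (e * b)) = v * (e * a) := by
    have hvv : v * v = 0 := by
      nth_rw 1 [← hve]
      rw [mul_assoc, hev, mul_zero]
    rw [mul_add, ← mul_assoc v v, hvv, zero_mul, add_zero]
  refine exists_units_of_eq_rightTranslate hΛ.1.isLattice (X := e * a + v * (e * b))
    (le_antisymm (fun z hz => ?_) ?_)
  · obtain ⟨α, β, h1⟩ := hab' z hz
    obtain ⟨γ, δ, h2⟩ := hab' (u * z) (hmem u hu z hz)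
    refine mem_rightTranslate.mpr ⟨α • e + β • u + (γ • v + δ • f), ?_, ?_⟩
    · exact add_mem (add_mem (O.smul_mem he _) (O.smul_mem hu _))
        (add_mem (O.smul_mem hv _) (O.smul_mem hf _))
    · have h3 : z = e * z + v * (e * (u * z)) := by
        rw [← mul_assoc e u, heu, ← mul_assoc, hvu, ← add_mul, hef, one_mul]
      rw [h3, h1, h2, add_mul, add_mul, add_mul]
      simp only [smul_mul_assoc, hXe, hXu, hXf, hXv, mul_add v, mul_smul_comm]
  · rintro _ ⟨w, hw, rfl⟩
    exact hmem w hw _ (add_mem (hmem e he a ha) (hmem v hv _ (hmem e he b hb)))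

/-- Invertible lattices over an order in a quaternion algebra over a henselian discrete valuation
ring are principal. -/
theorem exists_eq_rightTranslate [IsDomain A] [HenselianLocalRing A] [IsPrincipalIdealRing A]
    [Algebra.IsCentral F D] [IsSimpleRing D] (hdim : Module.finrank F D = 4)
    {O : Subalgebra A D} (hO : IsOrder F O) {Λ : Submodule A D} (hΛ : Λ ∈ leftIdeals F O) :
    ∃ x : Dˣ, Λ = rightTranslate (Subalgebra.toSubmodule O) (x : D) := by
  have : FiniteDimensional F D := Module.finite_of_finrank_pos (by omega)
  by_cases hidem : ∀ e ∈ O, e * e = e → e = 0 ∨ e = 1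
  · exact exists_units_of_forall_idempotent hdim hO hΛ hidem
  push Not at hidem
  obtain ⟨e, he, hee, he0, he1⟩ := hidem
  obtain ⟨f, hef⟩ : ∃ f, e + f = 1 := ⟨1 - e, add_sub_cancel _ _⟩
  have hf' : f = 1 - e := eq_sub_of_add_eq' hef
  have hf : f ∈ O := hf' ▸ sub_mem O.one_mem he
  have hf0 : f ≠ 0 := fun h => he1 (by rw [← hef, h, add_zero])
  have hef0 : e * f = 0 := by rw [hf', mul_sub, mul_one, hee, sub_self]
  have hfe0 : f * e = 0 := by rw [hf', sub_mul, one_mul, hee, sub_self]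
  have hff : f * f = f := by
    have := congr(f * $hef)
    rwa [mul_add, hfe0, zero_add, mul_one] at this
  obtain ⟨p, q, hpq⟩ := exists_peirce hdim hef hee he0 hf0
  have hinj := FaithfulSMul.algebraMap_injective A F
  have hce : ∀ z ∈ O, ∃ a : A, e * z * e = a • e := by
    intro z hz
    obtain ⟨α, hα⟩ := (hpq z).1
    obtain ⟨a, rfl⟩ := exists_mem_of_smul_mem hO hee he0
      (hα ▸ O.mul_mem (O.mul_mem he hz) he)
    exact ⟨a, by rw [hα, algebraMap_smul]⟩
  have hcf : ∀ z ∈ O, ∃ a : A, f * z * f = a • f := by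
    intro z hz
    obtain ⟨α, hα⟩ := (hpq z).2.1
    obtain ⟨a, rfl⟩ := exists_mem_of_smul_mem hO hff hf0
      (hα ▸ O.mul_mem (O.mul_mem hf hz) hf)
    exact ⟨a, by rw [hα, algebraMap_smul]⟩
  have hcanc : ∀ {a b : A} {x : D}, x ≠ 0 → a • x = b • x → a = b := by
    intro a b x hx h
    rw [← algebraMap_smul F, ← algebraMap_smul F b] at h
    exact hinj (smul_left_injective F hx h)
  -- If some product of off-diagonal elements is a unit multiple of `e`, then `O` contains a full
  -- set of matrix units.
  by_cases hunit : ∃ r ∈ O, ∃ s ∈ O, ∃ c : Aˣ, e * r * f * (f * s * e) = (c : A) • e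
  · obtain ⟨r, hr, s, hs, c, hc⟩ := hunit
    set u := e * r * f with hu
    set v := (↑c⁻¹ : A) • (f * s * e) with hv
    have huO : u ∈ O := O.mul_mem (O.mul_mem he hr) hf
    have hvO : v ∈ O := O.smul_mem (O.mul_mem (O.mul_mem hf hs) he) _
    have huv : u * v = e := by
      rw [hv, mul_smul_comm, hc, smul_smul, Units.inv_mul, one_smul]
    have heu : e * u = u := by rw [hu, ← mul_assoc, ← mul_assoc, hee]
    have huf : u * f = u := by rw [hu, mul_assoc, hff]
    have hue : u * e = 0 := by rw [← huf, mul_assoc, hfe0, mul_zero]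
    have hve : v * e = v := by rw [hv, smul_mul_assoc, mul_assoc, hee]
    have hfv : f * v = v := by rw [hv, mul_smul_comm, ← mul_assoc, ← mul_assoc, hff]
    -- `v u` lies in `f O f = A f`, say `v u = d f`; then `v = v u v = d v` forces `d = 1`.
    have hvu : v * u = f := by
      obtain ⟨d, hd⟩ := hcf (v * u) (O.mul_mem hvO huO)
      rw [← mul_assoc, hfv, mul_assoc, huf] at hd
      have hv0 : v ≠ 0 := fun h => he0 (by rw [← huv, h, mul_zero])
      have h1 : d • v = (1 : A) • v := by
        rw [one_smul]
        conv_rhs => rw [← hve, ← huv, ← mul_assoc, hd, smul_mul_assoc, hfv]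
      rw [hd, hcanc hv0 h1, one_smul]
    refine exists_units_of_matrix_units hΛ he hf huO hvO hef hee heu hue hve hfv huv hvu
      (p := p) fun z => ?_
    obtain ⟨α, hα⟩ := (hpq z).1
    obtain ⟨β, hβ⟩ := (hpq z).2.2.1
    exact ⟨α, β, by rw [← hα, ← hβ, ← mul_add, hef, mul_one]⟩
  -- Otherwise glue `e = x y` and `f = x' y'` to `X = x + x'`. With the off-diagonal errors `r = x
  -- y'` and `s = x' y`, one has `(x + x') (y + y') = 1 + r + s`. Multiplying by `1 - r - s` gives
  -- `(1 - c) e + (1 - d) f`, where `r s = c e` and `s r = d f`; it is invertible because `c` and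
  -- `d` are nonunits.
  obtain ⟨x, hx, y, hy, hex, hye, hxy⟩ := exists_mul_eq_idempotent hΛ he hee he0 hce
  obtain ⟨x', hx', y', hy', hfx, hyf, hxy'⟩ := exists_mul_eq_idempotent hΛ hf hff hf0 hcf
  have hΛO : ∀ a ∈ Λ, ∀ b ∈ latticeInv Λ, a * b ∈ O := fun a ha b hb =>
    (mul_latticeInv_eq hΛ).le (Submodule.mul_mem_mul ha hb)
  set r := x * y' with hr
  set s := x' * y with hs
  have hrO : r ∈ O := hΛO x hx y' hy'
  have hsO : s ∈ O := hΛO x' hx' y hy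
  have her : e * r = r := by rw [hr, ← mul_assoc, hex]
  have hrf : r * f = r := by rw [hr, mul_assoc, hyf]
  have hfs : f * s = s := by rw [hs, ← mul_assoc, hfx]
  have hse : s * e = s := by rw [hs, mul_assoc, hye]
  have hrr : r * r = 0 := by
    nth_rw 1 [← hrf]
    rw [mul_assoc, ← her, ← mul_assoc f, hfe0, zero_mul, mul_zero]
  have hss : s * s = 0 := by
    nth_rw 1 [← hse]
    rw [mul_assoc, ← hfs, ← mul_assoc e, hef0, zero_mul, mul_zero]
  obtain ⟨c, hc⟩ := hce (r * s) (O.mul_mem hrO hsO)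
  rw [← mul_assoc, her, mul_assoc, hse] at hc
  obtain ⟨d, hd⟩ := hcf (s * r) (O.mul_mem hsO hrO)
  rw [← mul_assoc, hfs, mul_assoc, hrf] at hd
  have hcu : ¬ IsUnit c := by
    rintro ⟨c, rfl⟩
    exact hunit ⟨r, hrO, s, hsO, c, by rw [her, hrf, hfs, hse, hc]⟩
  -- From `(s r) ^ 2 = s (r s) r` one gets `d ^ 2 = c d`; a unit `d` would thus equal the nonunit
  -- `c`.
  have hdu : ¬ IsUnit d := by
    intro hdu
    have h1 : (d * d) • f = (c * d) • f := by
      calc (d * d) • f = (s * r) * (s * r) := by rw [hd, smul_mul_smul_comm, hff]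
        _ = s * (r * s) * r := by simp only [mul_assoc]
        _ = (c * d) • f := by rw [hc, mul_smul_comm, hse, smul_mul_assoc, hd, smul_smul]
    exact hcu (mul_right_cancel₀ hdu.ne_zero (hcanc hf0 h1) ▸ hdu)
  obtain ⟨c', hc'⟩ := (IsLocalRing.isUnit_or_isUnit_one_sub_self c).resolve_left hcu
  obtain ⟨d', hd'⟩ := (IsLocalRing.isUnit_or_isUnit_one_sub_self d).resolve_left hdu
  have hXY : (x + x') * (y + y') = 1 + (r + s) := by
    rw [add_mul, mul_add, mul_add, hxy, hxy', ← hef]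
    abel
  have hinv : (1 + (r + s)) * (1 - (r + s)) = (c' : A) • e + (d' : A) • f := by
    have h1 : (1 + (r + s)) * (1 - (r + s)) = 1 - (r * r + r * s + (s * r + s * s)) := by
      noncomm_ring
    rw [h1, hrr, hss, hc, hd, hc', hd', ← hef]
    module
  refine exists_units_of_mul_eq_one hΛ (X := x + x')
    (Y := (y + y') * ((1 - (r + s)) * ((↑c'⁻¹ : A) • e + (↑d'⁻¹ : A) • f))) (add_mem hx hx')
    (mul_mem_latticeInv (add_mem hy hy') ?_) ?_
  · rw [hΛ.2]
    exact O.mul_mem (sub_mem O.one_mem (add_mem hrO hsO))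
      (add_mem (O.smul_mem he _) (O.smul_mem hf _))
  · rw [← mul_assoc, hXY, ← mul_assoc, hinv, add_mul, mul_add, mul_add]
    simp only [smul_mul_smul_comm, hee, hff, hef0, hfe0, smul_zero, Units.mul_inv, one_smul,
      add_zero, zero_add, hef]

end Local

/-! ### The completed rings of integers -/

section AdicCompletion

open IsDedekindDomain HeightOneSpectrum IsLocalRing WithZero Topology

variable {R : Type*} (K : Type*) [CommRing R] [IsDedekindDomain R] [Field K] [Algebra R K]
  [IsFractionRing R K] (v : HeightOneSpectrum R)

lemma exists_uniformizer_adicCompletionIntegers :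
    ∃ π : R, π ∈ v.asIdeal ∧
      Valued.v (algebraMap R (v.adicCompletion K) π) = exp (-1 : ℤ) ∧
      maximalIdeal (v.adicCompletionIntegers K) =
        Ideal.span {algebraMap R (v.adicCompletionIntegers K) π} := by
  obtain ⟨π, hπ⟩ := v.intValuation_exists_uniformizer
  have hvπ : Valued.v (algebraMap R (v.adicCompletion K) π) = exp (-1 : ℤ) := by
    rw [← hπ, ← valuation_of_algebraMap (K := K)]
    exact valuedAdicCompletion_eq_valuation v π
  refine ⟨π, ?_, hvπ, ?_⟩
  · rw [← v.intValuation_lt_one_iff_mem, hπ, ← exp_zero, exp_lt_exp]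
    norm_num
  · ext x
    rw [Ideal.mem_span_singleton, (adicCompletionIntegers.integers K v).dvd_iff_le,
      mem_maximalIdeal, mem_nonunits_iff, adicCompletionIntegers.isUnit_iff_valued_eq_one]
    change _ ↔ Valued.v (x : v.adicCompletion K) ≤ Valued.v (algebraMap R (v.adicCompletion K) π)
    rw [hvπ]
    have hx : Valued.v (x : v.adicCompletion K) ≤ 1 := x.2
    rw [← ne_eq, ← lt_iff_le_and_ne.trans (and_iff_right hx), ← exp_zero, ← lt_mul_exp_iff_le (by simp),
      ← exp_add]
    simp

lemma mem_span_uniformizer_pow_iff {π : R} (n : ℕ)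
    (x : v.adicCompletionIntegers K) :
    x ∈ Ideal.span {algebraMap R (v.adicCompletionIntegers K) π} ^ n ↔
      Valued.v (x : v.adicCompletion K) ≤
        Valued.v ((algebraMap R (v.adicCompletion K) π) ^ n) := by
  rw [Ideal.span_singleton_pow, Ideal.mem_span_singleton,
    (adicCompletionIntegers.integers K v).dvd_iff_le, ← map_pow, ← map_pow]
  rfl

instance isTopologicalRing_adicCompletionIntegers :
    IsTopologicalRing (v.adicCompletionIntegers K) :=
  inferInstanceAs (IsTopologicalRing (v.adicCompletionIntegers K).toSubring)

instance isUniformAddGroup_adicCompletionIntegers :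
    IsUniformAddGroup (v.adicCompletionIntegers K) :=
  inferInstanceAs (IsUniformAddGroup (v.adicCompletionIntegers K).toSubring.toAddSubgroup)

/-- Powers of the maximal ideal are the closed balls given by powers of a uniformizer. Hence
topological completeness becomes adic completeness, which yields Hensel's lemma. -/
lemma isAdic_maximalIdeal_adicCompletionIntegers :
    IsAdic (maximalIdeal (v.adicCompletionIntegers K)) := by
  obtain ⟨π, -, hvπ, hπ⟩ := exists_uniformizer_adicCompletionIntegers K v
  have hπ0 : algebraMap R (v.adicCompletion K) π ≠ 0 := by
    intro h
    rw [h, map_zero] at hvπ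
    exact exp_ne_zero hvπ.symm
  rw [hπ, isAdic_iff]
  refine ⟨fun n => ?_, fun s hs => ?_⟩
  · have h := Valued.isOpen_closedBall (v.adicCompletion K)
      (r := Valued.v.restrict ((algebraMap R (v.adicCompletion K) π) ^ n))
      (by simp [hπ0])
    convert h.preimage (continuous_subtype_val (p := (· ∈ v.adicCompletionIntegers K))) using 1
    ext x
    rw [SetLike.mem_coe, mem_span_uniformizer_pow_iff K v, ← Valuation.restrict_le_iff]
    rfl
  · obtain ⟨t, ht, hts⟩ := mem_nhds_induced _ _ _ |>.mp hs
    obtain ⟨γ, hγ⟩ := Valued.mem_nhds_zero.mp ht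
    have hlim := Valued.tendsto_zero_pow_of_le_exp_neg_one hvπ.le
    obtain ⟨n, hn⟩ := (hlim.eventually (Valued.mem_nhds_zero.mpr ⟨γ, subset_rfl⟩)).exists
    refine ⟨n, fun x hx => hts (hγ ?_)⟩
    rw [SetLike.mem_coe, mem_span_uniformizer_pow_iff K v, ← Valuation.restrict_le_iff] at hx
    exact hx.trans_lt hn

instance isAdicComplete_adicCompletionIntegers :
    IsAdicComplete (maximalIdeal (v.adicCompletionIntegers K)) (v.adicCompletionIntegers K) := by
  have : CompleteSpace (v.adicCompletionIntegers K) :=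
    (Valued.isClosed_valuationSubring (v.adicCompletion K)).completeSpace_coe
  exact (isAdic_maximalIdeal_adicCompletionIntegers K v).isAdicComplete_iff.mpr
    ⟨this, inferInstance⟩

instance henselianLocalRing_adicCompletionIntegers :
    HenselianLocalRing (v.adicCompletionIntegers K) where
  is_henselian f hf a h1 h2 :=
    HenselianRing.is_henselian f hf a h1 (h2.map (Ideal.Quotient.mk _))

/-- `R` is dense in the completed ring of integers. -/
lemma exists_sub_mem_map_pow (z : v.adicCompletionIntegers K) (n : ℕ) :
    ∃ r : R, z - algebraMap R (v.adicCompletionIntegers K) r ∈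
      (v.asIdeal ^ n).map (algebraMap R (v.adicCompletionIntegers K)) := by
  obtain ⟨π, hπv, hvπ, hπ⟩ := exists_uniformizer_adicCompletionIntegers K v
  have hπ0 : algebraMap R (v.adicCompletion K) π ≠ 0 := by
    intro h
    rw [h, map_zero] at hvπ
    exact exp_ne_zero hvπ.symm
  obtain ⟨k, hk⟩ : ∃ k : K, Valued.v ((z : v.adicCompletion K) - algebraMap K _ k) ≤
      Valued.v ((algebraMap R (v.adicCompletion K) π) ^ n) := by
    have h := Valued.isOpen_closedBall (v.adicCompletion K)
      (r := Valued.v.restrict ((algebraMap R (v.adicCompletion K) π) ^ n))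
      (by simp [hπ0])
    obtain ⟨k, hk⟩ := (denseRange_algebraMap K v).exists_mem_open
      (h.preimage (continuous_const.sub continuous_id : Continuous fun x => (z : v.adicCompletion K) - x))
      ⟨z, by simp⟩
    exact ⟨k, (Valuation.restrict_le_iff _).mp hk⟩
  have hπn : Valued.v ((algebraMap R (v.adicCompletion K) π) ^ n) ≤ 1 := by
    rw [map_pow, hvπ]
    exact pow_le_one' (by rw [← exp_zero, exp_le_exp]; norm_num) n
  -- The approximation `k ∈ K` given by density is itself integral at `v`, so it can be approximated
  -- further by an element of `R`.
  have hk1 : v.valuation K k ≤ 1 := by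
    rw [← valuedAdicCompletion_eq_valuation']
    have := Valued.v.map_sub_le z.2 (hk.trans hπn)
    rwa [sub_sub_cancel] at this
  obtain ⟨r, hr⟩ := v.exists_valuation_sub_lt_of_integer hk1
    (Units.mk0 (Valued.v ((algebraMap R (v.adicCompletion K) π) ^ n)) (by simp [hπ0]))
  refine ⟨r, ?_⟩
  have hle : Ideal.span {algebraMap R (v.adicCompletionIntegers K) π} ^ n ≤
      (v.asIdeal ^ n).map (algebraMap R (v.adicCompletionIntegers K)) := by
    rw [Ideal.map_pow]
    exact Ideal.pow_right_mono ((Ideal.span_singleton_le_iff_mem _).mpr (Ideal.mem_map_of_mem _ hπv)) n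
  refine hle ((mem_span_uniformizer_pow_iff K v n _).mpr ?_)
  have h2 : Valued.v (algebraMap K (v.adicCompletion K) (algebraMap R K r - k)) ≤
      Valued.v ((algebraMap R (v.adicCompletion K) π) ^ n) := by
    refine le_trans (le_of_eq ?_) hr.le
    exact valuedAdicCompletion_eq_valuation' v _
  have := Valued.v.map_sub_le hk h2
  convert this using 2
  rw [map_sub, ← IsScalarTower.algebraMap_apply, sub_sub, add_sub_cancel]
  rfl

end AdicCompletion

open IsDedekindDomain

/-! ### Lattices over a Dedekind domain and their completions -/

section Lattice

variable {R K B : Type*} [CommRing R] [IsDedekindDomain R] [Field K] [Algebra R K]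
  [IsFractionRing R K] [Ring B] [Algebra K B] [Algebra R B] [IsScalarTower R K B]

/-- Membership in a submodule can be checked locally. -/
lemma mem_of_forall_exists_smul_mem (v : HeightOneSpectrum R) {Y : Submodule R B} {x : B}
    (h : ∀ q : HeightOneSpectrum R, ∃ s ∉ q.asIdeal, s • x ∈ Y) : x ∈ Y := by
  let J : Ideal R := Y.comap (LinearMap.toSpanSingleton R B x)
  have hJ : ∀ r, r ∈ J ↔ r • x ∈ Y := fun r => Iff.rfl
  by_contra hx
  have hJ1 : J ≠ ⊤ := by
    rw [Ideal.ne_top_iff_one, hJ, one_smul]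
    exact hx
  obtain ⟨m, hm, hJm⟩ := Ideal.exists_le_maximal J hJ1
  -- The prime `v` is needed only here: over a field there are no primes to test at, and the
  -- hypothesis would be empty.
  have hR : ¬ IsField R := Ring.not_isField_iff_exists_prime.mpr ⟨v.asIdeal, v.ne_bot, v.isPrime⟩
  obtain ⟨s, hs, hsx⟩ := h ⟨m, hm.isPrime, Ring.ne_bot_of_isMaximal_of_not_isField hm hR⟩
  exact hs (hJm hsx)

lemma exists_smul_eq_algebraMap_of_valuation_le_one (v : HeightOneSpectrum R) {ι : Type*}
    [Finite ι] (k : ι → K) (hk : ∀ i, v.valuation K (k i) ≤ 1) :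
    ∃ s ∉ v.asIdeal, ∃ r : ι → R, ∀ i, s • k i = algebraMap R K (r i) := by
  classical
  have := Fintype.ofFinite ι
  choose n d h using fun i => v.exists_primeCompl_mul_eq_of_integer (k i) (hk i)
  refine ⟨∏ i, (d i : R), by simpa using (∏ i, d i).2,
    fun i => (∏ j ∈ Finset.univ.erase i, (d j : R)) * n i, fun i => ?_⟩
  rw [← Finset.prod_erase_mul _ _ (Finset.mem_univ i), mul_smul, map_mul, ← h, Algebra.smul_def,
    Algebra.smul_def (d i : R), mul_comm (k i)]

/-- A lattice has a `K`-basis which generates it locally at `v`. -/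
lemma exists_basis_of_isLattice (v : HeightOneSpectrum R) (M : Submodule R B)
    [hM : Submodule.IsLattice K M] :
    ∃ (n : ℕ) (b : Module.Basis (Fin n) K B), (∀ i, b i ∈ M) ∧
      ∀ m ∈ M, ∀ i, v.valuation K (b.repr m i) ≤ 1 := by
  set A := (v.valuation K).integer with hA
  have hRA : ∀ r : R, algebraMap R K r ∈ A := v.valuation_le_one
  -- Over the valuation ring at `v` the lattice generated by `M` is free. Its basis is moved into
  -- `M` by multipliers outside `v`, which do not affect integrality of coordinates at `v`.
  let M' : Submodule A B := Submodule.span A (M : Set B)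
  have : Submodule.IsLattice K M' := by
    refine ⟨?_, ?_⟩
    · obtain ⟨S, hS⟩ := hM.fg
      refine ⟨S, le_antisymm (Submodule.span_mono (hS ▸ Submodule.subset_span)) ?_⟩
      rw [Submodule.span_le]
      intro m hm
      rw [SetLike.mem_coe, ← hS] at hm
      induction hm using Submodule.span_induction with
      | mem x hx => exact Submodule.subset_span hx
      | zero => exact Submodule.zero_mem _
      | add x y _ _ hx hy => exact add_mem hx hy
      | smul r x _ hx =>
        have : r • x = (⟨algebraMap R K r, hRA r⟩ : A) • x := (algebraMap_smul K r x).symm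
        rw [this]
        exact Submodule.smul_mem _ _ hx
    · rw [← top_le_iff, ← hM.span_eq_top]
      exact Submodule.span_mono Submodule.subset_span
  have hfree : Module.Free A M' := Submodule.IsLattice.free K M'
  let c := Module.finBasis A M'
  have hclear : ∀ x ∈ M', ∃ s ∉ v.asIdeal, s • x ∈ M := by
    intro x hx
    induction hx using Submodule.span_induction with
    | mem x hx => exact ⟨1, v.asIdeal.primeCompl.one_mem, by simpa using hx⟩
    | zero => exact ⟨1, v.asIdeal.primeCompl.one_mem, by simp⟩
    | add x y _ _ hx hy =>
      obtain ⟨s, hs, hsx⟩ := hx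
      obtain ⟨t, ht, hty⟩ := hy
      refine ⟨s * t, v.asIdeal.primeCompl.mul_mem hs ht, ?_⟩
      rw [smul_add, mul_comm s, mul_smul, mul_comm t, mul_smul s]
      exact add_mem (M.smul_mem _ hsx) (M.smul_mem _ hty)
    | smul a x _ hx =>
      obtain ⟨s, hs, hsx⟩ := hx
      obtain ⟨n, d, h⟩ := v.exists_primeCompl_mul_eq_of_integer (a : K) a.2
      refine ⟨d * s, v.asIdeal.primeCompl.mul_mem d.2 hs, ?_⟩
      have : ((d : R) * s) • a • x = n • s • x := by
        change ((d : R) * s) • (a : K) • x = _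
        rw [← algebraMap_smul K, ← algebraMap_smul K n, ← algebraMap_smul K s, smul_smul,
          smul_smul, ← h, map_mul]
        congr 1
        ring
      rw [this]
      exact M.smul_mem _ hsx
  choose s hs hsM using fun i => hclear (c i) (c i).2
  have hs0 : ∀ i, IsUnit (algebraMap R K (s i)) := fun i => by
    rw [isUnit_iff_ne_zero, Ne, FaithfulSMul.algebraMap_eq_zero_iff]
    rintro h
    exact hs i (h ▸ v.asIdeal.zero_mem)
  let b := (c.extendOfIsLattice K).isUnitSMul hs0
  have hb : ∀ i, b i = s i • (c i : B) := fun i => by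
    rw [Module.Basis.isUnitSMul_apply, algebraMap_smul, Module.Basis.extendOfIsLattice_apply]
  refine ⟨_, b, fun i => hb i ▸ hsM i, fun m hm i => ?_⟩
  have hm' : m = ∑ j, ((algebraMap R K (s j))⁻¹ * (c.repr ⟨m, Submodule.subset_span hm⟩ j : K)) •
      b j := by
    have h := congrArg M'.subtype (c.sum_repr ⟨m, Submodule.subset_span hm⟩)
    rw [map_sum] at h
    refine h.symm.trans (Finset.sum_congr rfl fun j _ => ?_)
    rw [hb, ← algebraMap_smul K (s j), smul_smul, mul_right_comm, inv_mul_cancel₀ (hs0 j).ne_zero,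
      one_mul]
    rfl
  rw [hm', b.repr_sum_self, map_mul, map_inv₀, v.valuation_eq_one_iff_notMem.mpr (hs i), inv_one,
    one_mul]
  exact (c.repr ⟨m, Submodule.subset_span hm⟩ i).2

/-- The index annihilates the quotient. -/
lemma smul_mem_of_mem_latticeIndex (v : HeightOneSpectrum R) {Λ Λ' : Submodule R B}
    (hΛ : Submodule.IsLattice K Λ) (hle : Λ' ≤ Λ) {d : K} (hd : d ∈ latticeIndex K Λ Λ') {x : B} (hx : x ∈ Λ) : d • x ∈ Λ' := by
  induction hd using Submodule.span_induction with
  | zero => simp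
  | add a b _ _ ha hb => rw [add_smul]; exact add_mem ha hb
  | smul r a _ ha => rw [smul_assoc]; exact Λ'.smul_mem r ha
  | mem d hd =>
    obtain ⟨φ, hφ, rfl⟩ := hd
    -- Locally at `q` the matrix `T` of `φ` is integral, since `φ(Λ) ⊆ Λ' ⊆ Λ`. Therefore `det φ • x
    -- = φ(adj(T) x)`, with `adj(T) x` in `Λ` up to a factor prime to `q`.
    refine mem_of_forall_exists_smul_mem v fun q => ?_
    obtain ⟨n, b, hb, hrepr⟩ := exists_basis_of_isLattice (K := K) q Λ
    set T := LinearMap.toMatrix b b φ with hT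
    let T₀ : Matrix (Fin n) (Fin n) (q.valuation K).integer := fun i j =>
      ⟨T i j, by
        rw [hT, LinearMap.toMatrix_apply]
        exact hrepr _ (hle (hφ _ (hb j))) i⟩
    have hT₀ : T = (q.valuation K).integer.subtype.mapMatrix T₀ := rfl
    have hadj : ∀ i j, q.valuation K (T.adjugate i j) ≤ 1 := fun i j => by
      rw [hT₀, ← RingHom.map_adjugate]
      exact (T₀.adjugate i j).2
    have hcoord : ∀ i, q.valuation K (T.adjugate.mulVec (b.repr x) i) ≤ 1 := fun i => by
      change q.valuation K (∑ j, T.adjugate i j * b.repr x j) ≤ 1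
      refine Valuation.map_sum_le _ fun j _ => ?_
      rw [map_mul]
      exact mul_le_one' (hadj i j) (hrepr x hx j)
    obtain ⟨s, hs, r, hr⟩ := exists_smul_eq_algebraMap_of_valuation_le_one q _ hcoord
    refine ⟨s, hs, ?_⟩
    have hdet : LinearMap.det φ • x = φ (∑ i, T.adjugate.mulVec (b.repr x) i • b i) := by
      apply b.repr.injective
      ext i
      have h1 : T.mulVec (T.adjugate.mulVec (b.repr x)) = T.det • (b.repr x : Fin n → K) := by
        rw [Matrix.mulVec_mulVec, Matrix.mul_adjugate, Matrix.smul_mulVec, Matrix.one_mulVec]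
      have h2 := LinearMap.toMatrix_mulVec_repr b b φ (∑ i, T.adjugate.mulVec (b.repr x) i • b i)
      rw [← h2, ← hT]
      have h3 : (b.repr (∑ i, T.adjugate.mulVec (b.repr x) i • b i) : Fin n → K) =
          T.adjugate.mulVec (b.repr x) := by
        ext j
        rw [b.repr_sum_self]
      rw [h3, h1, hT, LinearMap.det_toMatrix]
      simp
    have : s • LinearMap.det φ • x = φ (∑ i, r i • b i) := by
      rw [hdet, ← algebraMap_smul K s, ← map_smul, Finset.smul_sum]
      congr 1
      refine Finset.sum_congr rfl fun i _ => ?_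
      rw [← algebraMap_smul K (r i), ← hr, smul_assoc, algebraMap_smul]
    rw [this]
    exact hφ _ (Submodule.sum_mem _ fun i _ => Λ.smul_mem _ (hb i))

end Lattice

section Scaling

variable {R K B : Type*} [CommRing R] [Field K] [Algebra R K]
  [IsFractionRing R K] [Ring B] [Algebra K B] [Algebra R B] [IsScalarTower R K B]

lemma span_eq_top_of_smul_mem {M N : Submodule R B} (hM : Submodule.span K (M : Set B) = ⊤)
    {r : R} (hr : r ≠ 0) (h : ∀ x ∈ M, r • x ∈ N) : Submodule.span K (N : Set B) = ⊤ := by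
  rw [← top_le_iff, ← hM, Submodule.span_le]
  intro x hx
  have hr0 : algebraMap R K r ≠ 0 := by simpa using hr
  have : x = (algebraMap R K r)⁻¹ • r • x := by
    rw [← algebraMap_smul K r, smul_smul, inv_mul_cancel₀ hr0, one_smul]
  rw [this]
  exact Submodule.smul_mem _ _ (Submodule.subset_span (h x hx))

end Scaling

/-! ### Completion of lattices at a prime, and gluing. -/

section Completion

variable {R K B : Type*} [CommRing R] [IsDedekindDomain R] [Field K] [Algebra R K]
  [IsFractionRing R K] [Ring B] [Algebra K B] [Algebra R B]
  (v : HeightOneSpectrum R)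

lemma tmul_mem_completion {M : Submodule R B} {x : B} (hx : x ∈ M) :
    (1 ⊗ₜ x : CompletedAlgebra K B v) ∈ completion K v M :=
  Submodule.subset_span ⟨x, hx, rfl⟩

lemma completion_le_iff {M : Submodule R B}
    {N : Submodule (v.adicCompletionIntegers K) (CompletedAlgebra K B v)} :
    completion K v M ≤ N ↔ ∀ x ∈ M, 1 ⊗ₜ x ∈ N := by
  rw [completion, Submodule.span_le]
  exact Set.image_subset_iff

lemma completion_mono {M N : Submodule R B} (h : M ≤ N) : completion K v M ≤ completion K v N :=
  (completion_le_iff v).mpr fun _ hx => tmul_mem_completion v (h hx)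

lemma toSubmodule_completionOrder (O : Subalgebra R B) :
    Subalgebra.toSubmodule (completionOrder K v O) =
      completion K v (Subalgebra.toSubmodule O) := rfl

variable [IsScalarTower R K B]

lemma one_tmul_smul (r : R) (x : B) :
    (1 ⊗ₜ (r • x) : CompletedAlgebra K B v) =
      algebraMap R (v.adicCompletionIntegers K) r • (1 ⊗ₜ x) := by
  have h : algebraMap R (v.adicCompletionIntegers K) r • (1 ⊗ₜ[K] x : CompletedAlgebra K B v) =
      (algebraMap R (v.adicCompletion K) r) ⊗ₜ x := by
    rw [TensorProduct.smul_tmul', Algebra.smul_def, mul_one]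
    rfl
  rw [h, ← algebraMap_smul K r x, TensorProduct.tmul_smul, TensorProduct.smul_tmul',
    Algebra.smul_def, mul_one, ← IsScalarTower.algebraMap_apply]

lemma completion_span (S : Set B) :
    completion K v (Submodule.span R S) = Submodule.span (v.adicCompletionIntegers K)
      ((Algebra.TensorProduct.includeRight : B →ₐ[K] CompletedAlgebra K B v) '' S) := by
  refine le_antisymm ((completion_le_iff v).mpr fun x hx => ?_)
    (Submodule.span_mono (Set.image_mono Submodule.subset_span))
  induction hx using Submodule.span_induction with
  | mem x hx => exact Submodule.subset_span ⟨x, hx, rfl⟩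
  | zero => simp
  | add x y _ _ hx hy => rw [TensorProduct.tmul_add]; exact add_mem hx hy
  | smul r x _ hx => rw [one_tmul_smul]; exact Submodule.smul_mem _ _ hx

lemma completion_mul (M N : Submodule R B) :
    completion K v (M * N) = completion K v M * completion K v N := by
  rw [Submodule.mul_eq_span_mul_set, completion_span, Set.image_mul, completion, completion,
    Submodule.span_mul_span]

instance isLattice_completion (M : Submodule R B) [hM : Submodule.IsLattice K M] :
    Submodule.IsLattice (v.adicCompletion K) (completion K v M) where
  fg := by
    obtain ⟨S, hS⟩ := hM.fg
    rw [← hS, completion_span]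
    exact Submodule.fg_span (S.finite_toSet.image _)
  span_eq_top := by
    refine top_le_iff.mp fun z hz => ?_
    clear hz
    induction z using TensorProduct.induction_on with
    | zero => exact zero_mem _
    | add x y hx hy => exact add_mem hx hy
    | tmul a x =>
      have hx : x ∈ Submodule.span K (M : Set B) := hM.span_eq_top ▸ Submodule.mem_top
      rw [← mul_one a, ← smul_eq_mul, ← TensorProduct.smul_tmul']
      refine Submodule.smul_mem _ _ ?_
      induction hx using Submodule.span_induction with
      | mem x hx => exact Submodule.subset_span (tmul_mem_completion v hx)
      | zero => simp
      | add x y _ _ hx hy => rw [TensorProduct.tmul_add]; exact add_mem hx hy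
      | smul k x _ hx =>
        rw [TensorProduct.tmul_smul, ← algebraMap_smul (v.adicCompletion K) k]
        exact Submodule.smul_mem _ _ hx

/-- In a basis generating `M` locally, elements of the completion have integral coordinates. Those
of `1 ⊗ x` are the coordinates of `x` in `K`, so they have a common denominator outside `v`. -/
lemma exists_smul_mem_of_tmul_mem_completion (M : Submodule R B) [Submodule.IsLattice K M] {x : B}
    (hx : (1 ⊗ₜ x : CompletedAlgebra K B v) ∈ completion K v M) :
    ∃ s ∉ v.asIdeal, s • x ∈ M := by
  obtain ⟨n, b, hb, hrepr⟩ := exists_basis_of_isLattice (K := K) v M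
  have hcoord : ∀ z ∈ completion K v M, ∀ i,
      (b.baseChange (v.adicCompletion K)).repr z i ∈ v.adicCompletionIntegers K := by
    intro z hz i
    induction hz using Submodule.span_induction with
    | mem z hz =>
      obtain ⟨m, hm, rfl⟩ := hz
      rw [Algebra.TensorProduct.includeRight_apply, Module.Basis.baseChange_repr_tmul,
        Algebra.smul_def, mul_one]
      refine (HeightOneSpectrum.mem_adicCompletionIntegers R K v).mpr ?_
      exact (HeightOneSpectrum.valuedAdicCompletion_eq_valuation' v _).trans_le (hrepr m hm i)
    | zero => simp
    | add y z _ _ hy hz => rw [map_add]; exact add_mem hy hz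
    | smul a z _ hz =>
      have : a • z = (a : v.adicCompletion K) • z := rfl
      rw [this, map_smul]
      exact mul_mem a.2 hz
  obtain ⟨s, hs, r, hr⟩ := exists_smul_eq_algebraMap_of_valuation_le_one v (b.repr x) (fun i => by
    have h := hcoord _ hx i
    rw [Module.Basis.baseChange_repr_tmul, Algebra.smul_def, mul_one] at h
    exact (HeightOneSpectrum.valuedAdicCompletion_eq_valuation' v _).symm.trans_le
      ((HeightOneSpectrum.mem_adicCompletionIntegers R K v).mp h))
  refine ⟨s, hs, ?_⟩
  rw [← b.sum_repr x, Finset.smul_sum]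
  refine Submodule.sum_mem _ fun i _ => ?_
  rw [← smul_assoc, hr, algebraMap_smul]
  exact M.smul_mem _ (hb i)

lemma le_of_forall_completion_le (v : HeightOneSpectrum R) (M N : Submodule R B)
    [Submodule.IsLattice K N]
    (h : ∀ q : HeightOneSpectrum R, completion K q M ≤ completion K q N) : M ≤ N := fun _ hx =>
  mem_of_forall_exists_smul_mem v fun q =>
    exists_smul_mem_of_tmul_mem_completion q N (h q (tmul_mem_completion q hx))

lemma eq_of_forall_completion_eq (v : HeightOneSpectrum R) (M N : Submodule R B)
    [Submodule.IsLattice K M] [Submodule.IsLattice K N]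
    (h : ∀ q : HeightOneSpectrum R, completion K q M = completion K q N) : M = N :=
  le_antisymm (le_of_forall_completion_le v M N fun q => (h q).le)
    (le_of_forall_completion_le v N M fun q => (h q).ge)

variable {v} {n : ℕ} {X Y : Submodule R B}

lemma smul_mem_completion_of_smul_le (h : ∀ r ∈ v.asIdeal ^ n, ∀ x ∈ X, r • x ∈ Y) {r : R}
    (hr : r ∈ v.asIdeal ^ n) {z : CompletedAlgebra K B v} (hz : z ∈ completion K v X) :
    algebraMap R (v.adicCompletionIntegers K) r • z ∈ completion K v Y := by
  induction hz using Submodule.span_induction with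
  | mem z hz =>
    obtain ⟨x, hx, rfl⟩ := hz
    rw [Algebra.TensorProduct.includeRight_apply, ← one_tmul_smul]
    exact tmul_mem_completion v (h r hr x hx)
  | zero => simp
  | add y z _ _ hy hz => rw [smul_add]; exact add_mem hy hz
  | smul a z _ hz => rw [smul_comm]; exact Submodule.smul_mem _ _ hz

lemma isLattice_of_smul_le [hX : Submodule.IsLattice K X] (hle : Y ≤ X)
    (h : ∀ r ∈ v.asIdeal ^ n, ∀ x ∈ X, r • x ∈ Y) : Submodule.IsLattice K Y where
  fg := by
    have : IsNoetherian R X := isNoetherian_of_isNoetherianRing_of_finite R X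
    exact Submodule.FG.of_le hX.fg hle
  span_eq_top := by
    obtain ⟨r, hr, hr0⟩ := Submodule.exists_mem_ne_zero_of_ne_bot (pow_ne_zero n v.ne_bot)
    exact span_eq_top_of_smul_mem hX.span_eq_top hr0 (h r hr)

/-- A lattice `Y` between `v ^ n X` and `X` is determined by its completion at `v`. -/
lemma mem_of_tmul_mem_completion [Submodule.IsLattice K Y]
    (h : ∀ r ∈ v.asIdeal ^ n, ∀ x ∈ X, r • x ∈ Y) {x : B} (hx : x ∈ X)
    (hxY : (1 ⊗ₜ x : CompletedAlgebra K B v) ∈ completion K v Y) : x ∈ Y := by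
  obtain ⟨s, hs, hsx⟩ := exists_smul_mem_of_tmul_mem_completion v Y hxY
  have hcop : IsCoprime (v.asIdeal ^ n) (Ideal.span {s}) := by
    refine IsCoprime.pow_left ?_
    rw [Ideal.isCoprime_iff_sup_eq]
    by_contra hne
    have := v.isMaximal.eq_of_le hne le_sup_left
    exact hs (this ▸ Ideal.mem_sup_right (Ideal.mem_span_singleton_self s))
  obtain ⟨r, hr, t, ht, hrt⟩ := Ideal.isCoprime_iff_exists.mp hcop
  obtain ⟨a, rfl⟩ := Ideal.mem_span_singleton'.mp ht
  rw [← one_smul R x, ← hrt, add_smul, mul_smul]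
  exact add_mem (h r hr x hx) (Y.smul_mem a hsx)

/-- `v ^ n` contains an element outside `q`, which is a unit in the completion at `q`. -/
lemma completion_eq_of_ne [Submodule.IsLattice K X] (hle : Y ≤ X)
    (h : ∀ r ∈ v.asIdeal ^ n, ∀ x ∈ X, r • x ∈ Y) {q : HeightOneSpectrum R} (hq : q ≠ v) :
    completion K q Y = completion K q X := by
  refine le_antisymm (completion_mono q hle) ((completion_le_iff q).mpr fun x hx => ?_)
  obtain ⟨r, hr, hrq⟩ : ∃ r ∈ v.asIdeal ^ n, r ∉ q.asIdeal := by
    by_contra! hle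
    have hle' : v.asIdeal ≤ q.asIdeal := q.isPrime.le_of_pow_le hle
    exact hq (HeightOneSpectrum.ext (v.isMaximal.eq_of_le q.isPrime.ne_top hle').symm)
  have hu : IsUnit (algebraMap R (q.adicCompletionIntegers K) r) := by
    rw [HeightOneSpectrum.adicCompletionIntegers.isUnit_iff_valued_eq_one]
    refine (HeightOneSpectrum.valuedAdicCompletion_eq_valuation q r).trans ?_
    exact q.valuation_eq_one_iff_notMem.mpr hrq
  obtain ⟨u, hu⟩ := hu
  have : (1 ⊗ₜ x : CompletedAlgebra K B q) =
      (↑u⁻¹ : q.adicCompletionIntegers K) • (1 ⊗ₜ (r • x)) := by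
    rw [one_tmul_smul, ← hu, smul_smul, Units.inv_mul, one_smul]
  rw [this]
  exact Submodule.smul_mem _ _ (tmul_mem_completion q (h r hr x hx))

/-- The elements of `X` whose image in `B_v` lies in `N`. -/
def localSubmodule (X : Submodule R B)
    (N : Submodule (v.adicCompletionIntegers K) (CompletedAlgebra K B v)) : Submodule R B where
  carrier := {x | x ∈ X ∧ 1 ⊗ₜ x ∈ N}
  add_mem' hx hy := ⟨add_mem hx.1 hy.1, by rw [TensorProduct.tmul_add]; exact add_mem hx.2 hy.2⟩
  zero_mem' := ⟨X.zero_mem, by simp⟩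
  smul_mem' r x hx := ⟨X.smul_mem r hx.1, by rw [one_tmul_smul]; exact Submodule.smul_mem _ _ hx.2⟩

variable {N : Submodule (v.adicCompletionIntegers K) (CompletedAlgebra K B v)}

lemma localSubmodule_le : localSubmodule X N ≤ X := fun _ hx => hx.1

lemma smul_mem_localSubmodule
    (h : ∀ r ∈ v.asIdeal ^ n, ∀ z ∈ completion K v X,
      algebraMap R (v.adicCompletionIntegers K) r • z ∈ N) :
    ∀ r ∈ v.asIdeal ^ n, ∀ x ∈ X, r • x ∈ localSubmodule X N := fun r hr x hx =>
  ⟨X.smul_mem r hx, by rw [one_tmul_smul]; exact h r hr _ (tmul_mem_completion v hx)⟩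

/-- Since `R` is dense, every `z` in the completion of `X` is congruent to some `x ∈ X` modulo the
completion of `localSubmodule X N`. That completion lies in `N`, so `z ∈ N` forces `x` into
`localSubmodule X N`. -/
lemma completion_localSubmodule (hN : N ≤ completion K v X)
    (h : ∀ r ∈ v.asIdeal ^ n, ∀ z ∈ completion K v X,
      algebraMap R (v.adicCompletionIntegers K) r • z ∈ N) :
    completion K v (localSubmodule X N) = N := by
  refine le_antisymm ((completion_le_iff v).mpr fun x hx => hx.2) fun z hz => ?_
  have hideal : ∀ a ∈ (v.asIdeal ^ n).map (algebraMap R (v.adicCompletionIntegers K)),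
      ∀ x ∈ X, a • (1 ⊗ₜ x : CompletedAlgebra K B v) ∈ completion K v (localSubmodule X N) := by
    intro a ha x hx
    have hle : (v.asIdeal ^ n).map (algebraMap R (v.adicCompletionIntegers K)) ≤
        (completion K v (localSubmodule X N)).comap
          (LinearMap.toSpanSingleton _ _ (1 ⊗ₜ x : CompletedAlgebra K B v)) := by
      refine Ideal.map_le_iff_le_comap.mpr fun r hr => ?_
      change algebraMap R (v.adicCompletionIntegers K) r • (1 ⊗ₜ x : CompletedAlgebra K B v) ∈
        completion K v (localSubmodule X N)
      rw [← one_tmul_smul]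
      exact tmul_mem_completion v (smul_mem_localSubmodule h r hr x hx)
    exact hle ha
  have happrox : ∀ z ∈ completion K v X, ∃ x ∈ X,
      z - 1 ⊗ₜ x ∈ completion K v (localSubmodule X N) := by
    intro z hz
    induction hz using Submodule.span_induction with
    | mem z hz =>
      obtain ⟨x, hx, rfl⟩ := hz
      exact ⟨x, hx, by simp⟩
    | zero => exact ⟨0, X.zero_mem, by simp⟩
    | add y z _ _ hy hz =>
      obtain ⟨x, hx, hxy⟩ := hy
      obtain ⟨x', hx', hxz⟩ := hz
      refine ⟨x + x', add_mem hx hx', ?_⟩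
      rw [TensorProduct.tmul_add, add_sub_add_comm]
      exact add_mem hxy hxz
    | smul a z _ hz =>
      obtain ⟨x, hx, hxz⟩ := hz
      obtain ⟨r, hr⟩ := exists_sub_mem_map_pow K v a n
      refine ⟨r • x, X.smul_mem r hx, ?_⟩
      have : a • z - 1 ⊗ₜ (r • x) = a • (z - 1 ⊗ₜ x) +
          (a - algebraMap R (v.adicCompletionIntegers K) r) • (1 ⊗ₜ x) := by
        rw [one_tmul_smul, smul_sub, sub_smul]
        abel
      rw [this]
      exact add_mem (Submodule.smul_mem _ _ hxz) (hideal _ hr x hx)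
  obtain ⟨x, hx, hxz⟩ := happrox z (hN hz)
  have hxN : 1 ⊗ₜ x ∈ N := by
    have := N.sub_mem hz
      ((completion_le_iff v).mpr (fun x (hx : x ∈ localSubmodule X N) => hx.2) hxz)
    rwa [sub_sub_cancel] at this
  have := add_mem hxz (tmul_mem_completion (K := K) v (M := localSubmodule X N) ⟨hx, hxN⟩)
  rwa [sub_add_cancel] at this

end Completion

/-! ### Translates of orders -/

section Translate

variable {R K B : Type*} [CommRing R] [Field K] [Algebra R K] [Ring B]
  [Algebra K B] [Algebra R B] [IsScalarTower R K B] {O O' : Subalgebra R B}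

lemma mem_unitGroup {u : Bˣ} : u ∈ unitGroup O ↔ (u : B) ∈ O ∧ ((u⁻¹ : Bˣ) : B) ∈ O := by
  rw [unitGroup, Submonoid.mem_units_iff]
  rfl

lemma mem_map_mulLeft_units {Λ : Submodule R B} {y : Bˣ} {z : B} :
    z ∈ Λ.map (LinearMap.mulLeft R ((y⁻¹ : Bˣ) : B)) ↔ y * z ∈ Λ := by
  constructor
  · rintro ⟨w, hw, rfl⟩
    simpa using hw
  · exact fun h => ⟨_, h, by simp⟩

lemma rightTranslate_mul_map_mulLeft (O : Subalgebra R B) (y : Bˣ) :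
    rightTranslate (Subalgebra.toSubmodule O) (y : B) *
      (Subalgebra.toSubmodule O).map (LinearMap.mulLeft R ((y⁻¹ : Bˣ) : B)) =
        Subalgebra.toSubmodule O := by
  refine le_antisymm (Submodule.mul_le.mpr ?_) fun z hz => ?_
  · rintro _ ⟨w, hw, rfl⟩ _ ⟨w', hw', rfl⟩
    simpa [mul_assoc] using O.mul_mem hw hw'
  · have := Submodule.mul_mem_mul
      (mem_rightTranslate_units (Λ := Subalgebra.toSubmodule O) (x := y) (z := z * y).mpr
        (by simpa using hz))
      (mem_map_mulLeft_units (Λ := Subalgebra.toSubmodule O) (y := y) (z := ((y⁻¹ : Bˣ) : B)).mpr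
        (by simp))
    simpa [mul_assoc] using this

lemma one_mem_map_mulLeft_mul_rightTranslate (O : Subalgebra R B) (y : Bˣ) :
    (1 : B) ∈ (Subalgebra.toSubmodule O).map (LinearMap.mulLeft R ((y⁻¹ : Bˣ) : B)) *
      rightTranslate (Subalgebra.toSubmodule O) (y : B) := by
  have := Submodule.mul_mem_mul
    (mem_map_mulLeft_units (Λ := Subalgebra.toSubmodule O) (y := y) (z := ((y⁻¹ : Bˣ) : B)).mpr
      (by simp))
    (mem_rightTranslate_units (Λ := Subalgebra.toSubmodule O) (x := y) (z := (y : B)).mpr (by simp))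
  simpa using this

lemma mul_mem_rightTranslate {y w z : B} (hw : w ∈ O)
    (hz : z ∈ rightTranslate (Subalgebra.toSubmodule O) y) :
    w * z ∈ rightTranslate (Subalgebra.toSubmodule O) y := by
  obtain ⟨t, ht, rfl⟩ := hz
  exact mem_rightTranslate.mpr ⟨w * t, O.mul_mem hw ht, mul_assoc _ _ _⟩

lemma rightTranslate_mem_leftIdeals (hO : IsOrder K O) (y : Bˣ) :
    rightTranslate (Subalgebra.toSubmodule O) (y : B) ∈ leftIdeals K O := by
  refine mem_leftIdeals_of_mul_eq ⟨hO.fg.map _, ?_⟩ (rightTranslate_mul_map_mulLeft O y)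
    (fun w hw z hz => mul_mem_rightTranslate hw hz) (one_mem_map_mulLeft_mul_rightTranslate O y)
  have h := Submodule.map_span (LinearMap.mulRight K (y : B)) (Subalgebra.toSubmodule O : Set B)
  rw [hO.span_eq_top] at h
  refine top_le_iff.mp fun z _ => ?_
  have hz : z ∈ Submodule.map (LinearMap.mulRight K (y : B)) ⊤ :=
    ⟨z * ((y⁻¹ : Bˣ) : B), Submodule.mem_top, by simp⟩
  rw [h] at hz
  exact hz

lemma mul_rightTranslate (hle : O' ≤ O) {α : Bˣ} (hα : α ∈ unitGroup O) (x : Bˣ) :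
    Subalgebra.toSubmodule O * rightTranslate (Subalgebra.toSubmodule O') ((α * x : Bˣ) : B) =
      rightTranslate (Subalgebra.toSubmodule O) (x : B) := by
  rw [mem_unitGroup] at hα
  refine le_antisymm (Submodule.mul_le.mpr ?_) ?_
  · rintro w hw _ ⟨t, ht, rfl⟩
    exact mem_rightTranslate.mpr
      ⟨w * t * α, O.mul_mem (O.mul_mem hw (hle ht)) hα.1, by simp [mul_assoc]⟩
  · rintro _ ⟨w, hw, rfl⟩
    have := Submodule.mul_mem_mul (M := Subalgebra.toSubmodule O) (O.mul_mem hw hα.2)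
      (mem_rightTranslate_units (Λ := Subalgebra.toSubmodule O') (x := α * x)
        (z := ((α * x : Bˣ) : B)).mpr (by rw [Units.mul_inv]; exact O'.one_mem))
    simpa [mul_assoc] using this

lemma rightTranslate_mem_Psi (hO' : IsOrder K O') (hle : O' ≤ O) {α : Bˣ} (hα : α ∈ unitGroup O)
    (x : Bˣ) : rightTranslate (Subalgebra.toSubmodule O') ((α * x : Bˣ) : B) ∈
      Psi K O' O (rightTranslate (Subalgebra.toSubmodule O) (x : B)) :=
  ⟨rightTranslate_mem_leftIdeals hO' _, mul_rightTranslate hle hα x⟩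

lemma exists_unit_of_mem_Psi (hle : O' ≤ O) {x y : Bˣ}
    (h : rightTranslate (Subalgebra.toSubmodule O') (y : B) ∈
      Psi K O' O (rightTranslate (Subalgebra.toSubmodule O) (x : B))) :
    ∃ α ∈ unitGroup O, y = α * x := by
  have h1 := mul_rightTranslate hle (unitGroup O).one_mem y
  rw [one_mul, h.2] at h1
  refine ⟨y * x⁻¹, mem_unitGroup.mpr ⟨?_, ?_⟩, by simp⟩
  · have : (y : B) ∈ rightTranslate (Subalgebra.toSubmodule O) (x : B) := by
      rw [h1, mem_rightTranslate_units, Units.mul_inv]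
      exact O.one_mem
    simpa using mem_rightTranslate_units.mp this
  · have : (x : B) ∈ rightTranslate (Subalgebra.toSubmodule O) (y : B) := by
      rw [← h1, mem_rightTranslate_units, Units.mul_inv]
      exact O.one_mem
    simpa using mem_rightTranslate_units.mp this

lemma rightTranslate_eq_iff {α β : Bˣ} (x : Bˣ) :
    rightTranslate (Subalgebra.toSubmodule O) ((α * x : Bˣ) : B) =
      rightTranslate (Subalgebra.toSubmodule O) ((β * x : Bˣ) : B) ↔
        α * β⁻¹ ∈ unitGroup O := by
  have key : ∀ {α β : Bˣ}, ((α * β⁻¹ : Bˣ) : B) ∈ O →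
      rightTranslate (Subalgebra.toSubmodule O) ((α * x : Bˣ) : B) ≤
        rightTranslate (Subalgebra.toSubmodule O) ((β * x : Bˣ) : B) := by
    rintro α β h _ ⟨w, hw, rfl⟩
    exact mem_rightTranslate.mpr ⟨_, O.mul_mem hw h, by simp [mul_assoc]⟩
  have key' : ∀ {α β : Bˣ}, rightTranslate (Subalgebra.toSubmodule O) ((α * x : Bˣ) : B) =
      rightTranslate (Subalgebra.toSubmodule O) ((β * x : Bˣ) : B) →
        ((α * β⁻¹ : Bˣ) : B) ∈ O := by
    intro α β h
    have h1 : ((α * x : Bˣ) : B) ∈ rightTranslate (Subalgebra.toSubmodule O) ((β * x : Bˣ) : B) := by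
      rw [← h, mem_rightTranslate_units, Units.mul_inv]
      exact O.one_mem
    simpa [mul_assoc] using mem_rightTranslate_units.mp h1
  refine ⟨fun h => mem_unitGroup.mpr ⟨key' h, ?_⟩, fun h => ?_⟩
  · rw [mul_inv_rev, inv_inv]
    exact key' h.symm
  · obtain ⟨h1, h2⟩ := mem_unitGroup.mp h
    rw [mul_inv_rev, inv_inv] at h2
    exact le_antisymm (key h1) (key h2)

/-- The inverse of `O x` is unique. This identifies the completion of `I⁻¹` from the product
identities alone, without commuting completion with `latticeInv`. -/
lemma eq_map_mulLeft_of_mul_eq {L : Submodule R B} {x : Bˣ}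
    (h1 : rightTranslate (Subalgebra.toSubmodule O) (x : B) * L = Subalgebra.toSubmodule O)
    (h2 : ∀ l ∈ L, ∀ w ∈ O, l * w ∈ L)
    (h3 : (1 : B) ∈ L * rightTranslate (Subalgebra.toSubmodule O) (x : B)) :
    L = (Subalgebra.toSubmodule O).map (LinearMap.mulLeft R ((x⁻¹ : Bˣ) : B)) := by
  have h : ∀ z ∈ L * rightTranslate (Subalgebra.toSubmodule O) (x : B),
      z * ((x⁻¹ : Bˣ) : B) ∈ L := by
    intro z hz
    induction hz using Submodule.mul_induction_on' with
    | mem_mul_mem l hl w hw =>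
      rw [mul_assoc]
      exact h2 l hl _ (mem_rightTranslate_units.mp hw)
    | add a _ b _ ha hb =>
      rw [add_mul]
      exact add_mem ha hb
  refine le_antisymm (fun l hl => mem_map_mulLeft_units.mpr ?_) ?_
  · rw [← h1]
    refine Submodule.mul_mem_mul (mem_rightTranslate_units.mpr ?_) hl
    rw [Units.mul_inv]
    exact O.one_mem
  · rintro _ ⟨w, hw, rfl⟩
    exact h2 _ (by simpa using h 1 h3) w hw

end Translate

/-! ### Operations on lattices -/

section Operations

variable {R K B : Type*} [CommRing R] [Field K] [Algebra R K]
  [IsFractionRing R K] [Ring B] [Algebra K B] [Algebra R B] [IsScalarTower R K B]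

lemma exists_smul_mem_of_span_eq_top [IsDomain R] {N : Submodule R B}
    (hN : Submodule.span K (N : Set B) = ⊤) (x : B) : ∃ r : R, r ≠ 0 ∧ r • x ∈ N := by
  have hx : x ∈ Submodule.span K (N : Set B) := hN ▸ Submodule.mem_top
  induction hx using Submodule.span_induction with
  | mem x hx => exact ⟨1, one_ne_zero, by simpa using hx⟩
  | zero => exact ⟨1, one_ne_zero, by simp⟩
  | add x y _ _ hx hy =>
    obtain ⟨r, hr, hrx⟩ := hx
    obtain ⟨s, hs, hsy⟩ := hy
    refine ⟨r * s, mul_ne_zero hr hs, ?_⟩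
    rw [smul_add, mul_comm r, mul_smul, mul_comm s, mul_smul r]
    exact add_mem (N.smul_mem _ hrx) (N.smul_mem _ hsy)
  | smul k x _ hx =>
    obtain ⟨r, hr, hrx⟩ := hx
    obtain ⟨⟨a, s⟩, has⟩ := IsLocalization.surj (nonZeroDivisors R) k
    refine ⟨s * r, mul_ne_zero (nonZeroDivisors.ne_zero s.2) hr, ?_⟩
    have : ((s : R) * r) • k • x = a • r • x := by
      rw [← algebraMap_smul K, ← algebraMap_smul K a, ← algebraMap_smul K r, smul_smul,
        smul_smul, ← has, map_mul]
      congr 1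
      ring
    rw [this]
    exact N.smul_mem _ hrx

lemma exists_smul_le_of_span_eq_top [IsDomain R] {M N : Submodule R B} (hM : M.FG)
    (hN : Submodule.span K (N : Set B) = ⊤) : ∃ r : R, r ≠ 0 ∧ ∀ x ∈ M, r • x ∈ N := by
  classical
  obtain ⟨S, rfl⟩ := hM
  choose r hr hrN using exists_smul_mem_of_span_eq_top hN
  refine ⟨∏ x ∈ S, r x, Finset.prod_ne_zero_iff.mpr fun x _ => hr x, fun x hx => ?_⟩
  induction hx using Submodule.span_induction with
  | mem x hx =>
    rw [← Finset.prod_erase_mul _ _ hx, mul_smul]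
    exact N.smul_mem _ (hrN x)
  | zero => simp
  | add x y _ _ hx hy => rw [smul_add]; exact add_mem hx hy
  | smul a x _ hx => rw [smul_comm]; exact N.smul_mem _ hx

lemma isLattice_mul [IsDomain R] {M N : Submodule R B} (hM : Submodule.IsLattice K M)
    (hN : Submodule.IsLattice K N) : Submodule.IsLattice K (M * N) := by
  obtain ⟨r, hr, hrM⟩ := exists_smul_mem_of_span_eq_top hM.span_eq_top (1 : B)
  refine ⟨hM.fg.mul hN.fg, span_eq_top_of_smul_mem hN.span_eq_top hr fun x hx => ?_⟩
  have := Submodule.mul_mem_mul hrM hx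
  rwa [smul_one_mul] at this

/-- If `r • 1 ∈ Λ`, then `r Λ⁻¹ ⊆ Λ Λ⁻¹ = O`, which bounds `Λ⁻¹` above. If `s Λ ⊆ O`, then `s O ⊆
Λ⁻¹`, so `Λ⁻¹` spans. -/
lemma isLattice_latticeInv [IsDomain R] [IsNoetherianRing R] {O : Subalgebra R B}
    (hO : IsOrder K O) {Λ : Submodule R B} (hΛ : Λ ∈ leftIdeals K O) :
    Submodule.IsLattice K (latticeInv Λ) := by
  obtain ⟨r, hr, hrΛ⟩ := exists_smul_mem_of_span_eq_top hΛ.1.isLattice.span_eq_top (1 : B)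
  obtain ⟨s, hs, hsΛ⟩ := exists_smul_le_of_span_eq_top hΛ.1.isLattice.fg hO.span_eq_top
  refine ⟨?_, span_eq_top_of_smul_mem hO.span_eq_top hs fun x hx a ha b hb => ?_⟩
  · refine Submodule.FG.of_le
      (hO.fg.map (LinearMap.mulLeft R (algebraMap K B (algebraMap R K r)⁻¹))) fun y hy => ?_
    have h := (mul_latticeInv_eq hΛ).le (Submodule.mul_mem_mul hrΛ hy)
    refine ⟨_, h, ?_⟩
    have hr0 : algebraMap R K r ≠ 0 := by simpa using hr
    rw [LinearMap.mulLeft_apply, ← Algebra.smul_def, smul_one_mul, ← algebraMap_smul K r, smul_smul,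
      inv_mul_cancel₀ hr0, one_smul]
  · rw [mul_smul_comm, ← smul_mul_assoc]
    exact mul_mem_of_mem_leftIdeals hΛ (O.mul_mem (hsΛ a ha) hx) hb

lemma smul_mem_mul {a b : Ideal R} {X Y X' Y' : Submodule R B} (h : ∀ r ∈ a, ∀ x ∈ X, r • x ∈ Y)
    (h' : ∀ r ∈ b, ∀ x ∈ X', r • x ∈ Y') : ∀ r ∈ a * b, ∀ x ∈ X * X', r • x ∈ Y * Y' := by
  intro r hr x hx
  induction hr using Submodule.mul_induction_on' with
  | add r _ s _ hr hs => rw [add_smul]; exact add_mem hr hs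
  | mem_mul_mem r hr s hs =>
    induction hx using Submodule.mul_induction_on' with
    | add x _ y _ hx hy => rw [smul_add]; exact add_mem hx hy
    | mem_mul_mem x hx y hy =>
      rw [← smul_mul_smul_comm]
      exact Submodule.mul_mem_mul (h r hr x hx) (h' s hs y hy)

end Operations

section LeftIdeals

variable {R K B : Type*} [CommRing R] [Field K] [Algebra R K] [Ring B]
  [Algebra K B] [Algebra R B] [IsScalarTower R K B] {O O' : Subalgebra R B} {I J : Submodule R B}

lemma latticeInv_mul_le_latticeInv (hI : I ∈ leftIdeals K O) :
    latticeInv I * Subalgebra.toSubmodule O ≤ latticeInv I :=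
  Submodule.mul_le.mpr fun _ hx _ hy =>
    mul_mem_latticeInv hx (by rw [hI.2]; exact hy)

lemma toSubmodule_mul_le (hI : I ∈ leftIdeals K O) : Subalgebra.toSubmodule O * I ≤ I :=
  Submodule.mul_le.mpr fun _ hx _ hy => mul_mem_of_mem_leftIdeals hI hx hy

lemma le_of_mem_Psi (hJ : J ∈ Psi K O' O I) : J ≤ I := fun x hx => by
  rw [← hJ.2, ← one_mul x]
  exact Submodule.mul_mem_mul O.one_mem hx

/-- `a I = a O J ⊆ O' J ⊆ J`. Together with `le_of_mem_Psi` this confines `J` between `a I` and `I`.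
-/
lemma smul_mem_of_mem_Psi {a : Ideal R} (h : ∀ r ∈ a, ∀ x ∈ O, r • x ∈ O')
    (hJ : J ∈ Psi K O' O I) : ∀ r ∈ a, ∀ x ∈ I, r • x ∈ J := by
  intro r hr x hx
  rw [← hJ.2] at hx
  induction hx using Submodule.mul_induction_on' with
  | mem_mul_mem w hw y hy =>
    rw [← smul_mul_assoc]
    exact mul_mem_of_mem_leftIdeals hJ.1 (h r hr w hw) hy
  | add x _ y _ hx hy => rw [smul_add]; exact add_mem hx hy

lemma rightTranslate_le (hle : O' ≤ O) (y : B) :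
    rightTranslate (Subalgebra.toSubmodule O') y ≤ rightTranslate (Subalgebra.toSubmodule O) y :=
  Submodule.map_mono hle

end LeftIdeals

/-! ### Left ideals and their completions -/

section LocalGlobal

variable {R K B : Type*} [CommRing R] [IsDedekindDomain R] [Field K] [Algebra R K]
  [IsFractionRing R K] [Ring B] [Algebra K B] [Algebra R B] [IsScalarTower R K B]
  {v : HeightOneSpectrum R} {n : ℕ} {O O' : Subalgebra R B} {I J : Submodule R B}

lemma isOrder_completionOrder (v : HeightOneSpectrum R) (hO : IsOrder K O) :
    IsOrder (v.adicCompletion K) (completionOrder K v O) :=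
  isLattice_completion v _ (hM := hO)

lemma completionOrder_mono (v : HeightOneSpectrum R) (hle : O' ≤ O) :
    completionOrder K v O' ≤ completionOrder K v O :=
  completion_mono v (M := Subalgebra.toSubmodule O') (N := Subalgebra.toSubmodule O) hle

lemma completion_mem_leftIdeals (v : HeightOneSpectrum R) (hI : I ∈ leftIdeals K O) :
    completion K v I ∈ leftIdeals (v.adicCompletion K) (completionOrder K v O) := by
  refine mem_leftIdeals_of_mul_eq (Λ' := completion K v (latticeInv I))
    (isLattice_completion v I (hM := hI.1.isLattice)) ?_ (fun x hx y hy => ?_) ?_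
  · rw [← completion_mul, mul_latticeInv_eq hI, toSubmodule_completionOrder]
  · have := Submodule.mul_mem_mul (M := completion K v (Subalgebra.toSubmodule O)) hx hy
    rw [← completion_mul] at this
    exact completion_mono v (toSubmodule_mul_le hI) this
  · rw [← completion_mul]
    exact tmul_mem_completion v (one_mem_latticeInv_mul hI)

lemma completion_mem_Psi (v : HeightOneSpectrum R) (hJ : J ∈ Psi K O' O I) :
    completion K v J ∈ Psi (v.adicCompletion K) (completionOrder K v O') (completionOrder K v O)
      (completion K v I) :=
  ⟨completion_mem_leftIdeals v hJ.1, by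
    rw [toSubmodule_completionOrder, ← completion_mul, hJ.2]⟩

lemma injOn_completion_Psi (h : ∀ r ∈ v.asIdeal ^ n, ∀ x ∈ O, r • x ∈ O') :
    Set.InjOn (completion K v) (Psi K O' O I) := by
  have key : ∀ J₁ ∈ Psi K O' O I, ∀ J₂ ∈ Psi K O' O I,
      completion K v J₁ ≤ completion K v J₂ → J₁ ≤ J₂ := by
    intro J₁ h₁ J₂ h₂ hle x hx
    have : Submodule.IsLattice K J₂ := h₂.1.1.isLattice
    exact mem_of_tmul_mem_completion (smul_mem_of_mem_Psi h h₂) (le_of_mem_Psi h₁ hx)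
      (hle (tmul_mem_completion v hx))
  exact fun J₁ h₁ J₂ h₂ heq => le_antisymm (key _ h₁ _ h₂ heq.le) (key _ h₂ _ h₁ heq.ge)

lemma completion_latticeInv (hI : I ∈ leftIdeals K O) {y : (CompletedAlgebra K B v)ˣ}
    (hy : completion K v I =
      rightTranslate (Subalgebra.toSubmodule (completionOrder K v O)) (y : CompletedAlgebra K B v)) :
    completion K v (latticeInv I) = (Subalgebra.toSubmodule (completionOrder K v O)).map
      (LinearMap.mulLeft _ ((y⁻¹ : (CompletedAlgebra K B v)ˣ) : CompletedAlgebra K B v)) := by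
  refine eq_map_mulLeft_of_mul_eq ?_ (fun l hl w hw => ?_) ?_
  · rw [← hy, ← completion_mul, mul_latticeInv_eq hI, toSubmodule_completionOrder]
  · have := Submodule.mul_mem_mul (N := completion K v (Subalgebra.toSubmodule O)) hl hw
    rw [← completion_mul] at this
    exact completion_mono v (latticeInv_mul_le_latticeInv hI) this
  · rw [← hy, ← completion_mul]
    exact tmul_mem_completion v (one_mem_latticeInv_mul hI)

lemma smul_mem_rightTranslate_completionOrder (h : ∀ r ∈ v.asIdeal ^ n, ∀ x ∈ O, r • x ∈ O')
    (y : CompletedAlgebra K B v) : ∀ r ∈ v.asIdeal ^ n,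
      ∀ z ∈ rightTranslate (Subalgebra.toSubmodule (completionOrder K v O)) y,
        algebraMap R (v.adicCompletionIntegers K) r • z ∈
          rightTranslate (Subalgebra.toSubmodule (completionOrder K v O')) y := by
  rintro r hr _ ⟨w, hw, rfl⟩
  exact ⟨_, smul_mem_completion_of_smul_le (X := Subalgebra.toSubmodule O) h hr hw,
    map_smul _ _ _⟩

/-- The inverse of `M` is the part `M'` of `I⁻¹` lying locally in `y⁻¹ O'_v`. The relations `M M' =
O'`, `1 ∈ M' M` and `O M = I` need checking only at `v`, because the lattices in question contain `v
^ n` or `v ^ (2n)` times one of `O = I I⁻¹`, `I⁻¹ I` and `I`, inside which everything takes place.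
-/
lemma localSubmodule_mem_Psi (hO : IsOrder K O) (hO' : IsOrder K O') (hle : O' ≤ O)
    (h : ∀ r ∈ v.asIdeal ^ n, ∀ x ∈ O, r • x ∈ O') (hI : I ∈ leftIdeals K O)
    {y : (CompletedAlgebra K B v)ˣ} (hy : completion K v I =
      rightTranslate (Subalgebra.toSubmodule (completionOrder K v O)) (y : CompletedAlgebra K B v)) :
    localSubmodule I (rightTranslate (Subalgebra.toSubmodule (completionOrder K v O'))
      (y : CompletedAlgebra K B v)) ∈ Psi K O' O I := by
  have hle' := completionOrder_mono (K := K) v hle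
  have hcL := completion_latticeInv hI hy
  set L := latticeInv I with hL
  set N := rightTranslate (Subalgebra.toSubmodule (completionOrder K v O'))
    (y : CompletedAlgebra K B v) with hN
  set N' := (Subalgebra.toSubmodule (completionOrder K v O')).map
    (LinearMap.mulLeft (v.adicCompletionIntegers K)
      ((y⁻¹ : (CompletedAlgebra K B v)ˣ) : CompletedAlgebra K B v)) with hN'
  have hNI : ∀ r ∈ v.asIdeal ^ n, ∀ z ∈ completion K v I,
      algebraMap R (v.adicCompletionIntegers K) r • z ∈ N := by
    rw [hy]
    exact smul_mem_rightTranslate_completionOrder h _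
  have hNL : ∀ r ∈ v.asIdeal ^ n, ∀ z ∈ completion K v L,
      algebraMap R (v.adicCompletionIntegers K) r • z ∈ N' := by
    rw [hcL]
    rintro r hr _ ⟨w, hw, rfl⟩
    exact ⟨_, smul_mem_completion_of_smul_le (X := Subalgebra.toSubmodule O) h hr hw,
      map_smul _ _ _⟩
  have hMc : completion K v (localSubmodule I N) = N :=
    completion_localSubmodule (hy ▸ rightTranslate_le hle' _) hNI
  have hMc' : completion K v (localSubmodule L N') = N' :=
    completion_localSubmodule (hcL ▸ Submodule.map_mono hle') hNL
  have hM := smul_mem_localSubmodule hNI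
  have hM' := smul_mem_localSubmodule hNL
  have hIlat : Submodule.IsLattice K I := hI.1.isLattice
  have hLlat : Submodule.IsLattice K L := isLattice_latticeInv hO hI
  set M := localSubmodule I N with hMdef
  set M' := localSubmodule L N' with hMdef'
  have hMI : M ≤ I := localSubmodule_le
  have hML : M' ≤ L := localSubmodule_le
  have hMlat : Submodule.IsLattice K M := isLattice_of_smul_le hMI hM
  have hMlat' : Submodule.IsLattice K M' := isLattice_of_smul_le hML hM'
  have hIL : I * L = Subalgebra.toSubmodule O := mul_latticeInv_eq hI
  refine ⟨mem_leftIdeals_of_mul_eq (Λ' := M') hMlat ?_ (fun x hx z hz => ⟨?_, ?_⟩) ?_, ?_⟩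
  · have hc : completion K v (M * M') = completion K v (Subalgebra.toSubmodule O') := by
      rw [completion_mul, hMc, hMc', hN, hN', rightTranslate_mul_map_mulLeft,
        toSubmodule_completionOrder]
    refine le_antisymm (fun z hz => ?_) (fun z hz => ?_)
    · have : Submodule.IsLattice K (Subalgebra.toSubmodule O') := hO'
      refine mem_of_tmul_mem_completion (X := Subalgebra.toSubmodule O) h ?_
        (hc ▸ tmul_mem_completion v hz)
      rw [← hIL]
      exact mul_le_mul' hMI hML hz
    · have := isLattice_mul hMlat hMlat'
      have hs := smul_mem_mul hM hM'
      rw [← pow_add] at hs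
      refine mem_of_tmul_mem_completion hs ?_ (hc.symm ▸ tmul_mem_completion v hz)
      rw [hIL]
      exact hle hz
  · exact mul_mem_of_mem_leftIdeals hI (hle hx) hz.1
  · have := mul_mem_rightTranslate (O := completionOrder K v O')
      (tmul_mem_completion v (M := Subalgebra.toSubmodule O') hx) hz.2
    rwa [Algebra.TensorProduct.tmul_mul_tmul, one_mul] at this
  · have := isLattice_mul hMlat' hMlat
    have hs := smul_mem_mul hM' hM
    rw [← pow_add] at hs
    refine mem_of_tmul_mem_completion hs (one_mem_latticeInv_mul hI) ?_
    rw [completion_mul, hMc, hMc']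
    exact one_mem_map_mulLeft_mul_rightTranslate _ _
  · refine le_antisymm ((mul_le_mul' le_rfl hMI).trans (toSubmodule_mul_le hI)) ?_
    have := isLattice_mul hO hMlat
    refine fun x hx => mem_of_tmul_mem_completion (v := v) (X := I) (n := n) (fun r hr z hz => ?_) hx ?_
    · rw [← one_mul (r • z)]
      exact Submodule.mul_mem_mul O.one_mem (hM r hr z hz)
    · have h1 := mul_rightTranslate hle' (unitGroup (completionOrder K v O)).one_mem y
      rw [one_mul, ← hy, toSubmodule_completionOrder, ← hN, ← hMc, ← completion_mul] at h1
      rw [h1]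
      exact tmul_mem_completion v hx

lemma completion_localSubmodule_rightTranslate (hle : O' ≤ O)
    (h : ∀ r ∈ v.asIdeal ^ n, ∀ x ∈ O, r • x ∈ O')
    {y : CompletedAlgebra K B v} (hy : completion K v I =
      rightTranslate (Subalgebra.toSubmodule (completionOrder K v O)) y) :
    completion K v (localSubmodule I
      (rightTranslate (Subalgebra.toSubmodule (completionOrder K v O')) y)) =
        rightTranslate (Subalgebra.toSubmodule (completionOrder K v O')) y := by
  refine completion_localSubmodule (n := n) (hy ▸ rightTranslate_le (completionOrder_mono v hle) _)
    ?_
  rw [hy]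
  exact smul_mem_rightTranslate_completionOrder h _

end LocalGlobal

/-! ### Counting by cosets of unit groups. -/

section Index

variable {R K B : Type*} [CommRing R] [Field K] [Algebra R K] [Ring B]
  [Algebra K B] [Algebra R B] [IsScalarTower R K B] {O O' : Subalgebra R B}

/-- The quotient is by cosets `a O'ˣ`, whereas `O' α x` depends on `O'ˣ α`; hence `a` is sent to `O'
a⁻¹ x`. -/
lemma nonempty_quotient_equiv_Psi (hO' : IsOrder K O') (hle : O' ≤ O) (x : Bˣ)
    (hprinc : ∀ Λ ∈ leftIdeals K O', ∃ y : Bˣ,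
      Λ = rightTranslate (Subalgebra.toSubmodule O') (y : B)) :
    Nonempty ((unitGroup O ⧸ (unitGroup O').subgroupOf (unitGroup O)) ≃
      Psi K O' O (rightTranslate (Subalgebra.toSubmodule O) (x : B))) := by
  have hrel : ∀ a b : unitGroup O, (a : unitGroup O ⧸ (unitGroup O').subgroupOf (unitGroup O)) = b ↔
      rightTranslate (Subalgebra.toSubmodule O') (((a : Bˣ)⁻¹ * x : Bˣ) : B) =
        rightTranslate (Subalgebra.toSubmodule O') (((b : Bˣ)⁻¹ * x : Bˣ) : B) := fun a b => by
    rw [QuotientGroup.eq, rightTranslate_eq_iff, Subgroup.mem_subgroupOf, inv_inv]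
    rfl
  refine ⟨Equiv.ofBijective (Quotient.lift (fun a : unitGroup O =>
    (⟨_, rightTranslate_mem_Psi hO' hle (inv_mem a.2) x⟩ :
      Psi K O' O (rightTranslate (Subalgebra.toSubmodule O) (x : B))))
    fun a b hab => Subtype.ext ((hrel a b).mp (Quotient.sound hab))) ⟨?_, ?_⟩⟩
  · rintro ⟨a⟩ ⟨b⟩ hab
    exact (hrel a b).mpr (Subtype.ext_iff.mp hab)
  · rintro ⟨Λ, hΛ⟩
    obtain ⟨y, rfl⟩ := hprinc Λ hΛ.1
    obtain ⟨α, hα, rfl⟩ := exists_unit_of_mem_Psi hle hΛ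
    exact ⟨((⟨α⁻¹, inv_mem hα⟩ : unitGroup O) : unitGroup O ⧸ _), Subtype.ext (by
      change rightTranslate _ (((α⁻¹)⁻¹ * x : Bˣ) : B) = _
      rw [inv_inv])⟩

end Index

end QuaternionIdeals

open QuaternionIdeals IsDedekindDomain in
theorem mainTheorem7
    {R : Type uR} {K : Type uK} {B : Type uB} [CommRing R] [IsDedekindDomain R] [Field K] [Algebra R K] [IsFractionRing R K]
    [Ring B] [Algebra K B] [Algebra R B] [IsScalarTower R K B]
    [Algebra.IsCentral K B] [IsSimpleRing B] (hdim : Module.finrank K B = 4)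
    (O O' : Subalgebra R B) (hO : IsOrder K O) (hO' : IsOrder K O') (hle : O' ≤ O)
    (p : HeightOneSpectrum R) (e : ℕ) (he : 1 ≤ e)
    (hindex : latticeIndex K (Subalgebra.toSubmodule O) (Subalgebra.toSubmodule O') =
      IsLocalization.coeSubmodule K (p.asIdeal ^ e))
    (I : Submodule R B) (hI : I ∈ leftIdeals K O) :
    -- `J ↦ J_p` is a bijection from `Ψ(I)` to `Ψ(I_p)`
    Set.BijOn (completion K p) (Psi K O' O I)
      (Psi (p.adicCompletion K) (completionOrder K p O') (completionOrder K p O)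
        (completion K p I)) ∧
    -- `#Ψ(I) = [O_pˣ : O'_pˣ]`, as cardinal numbers and as a (possibly infinite) index
    Cardinal.lift.{uK} (Cardinal.mk (Psi K O' O I)) =
      (Cardinal.mk (unitGroup (completionOrder K p O) ⧸
        (unitGroup (completionOrder K p O')).subgroupOf (unitGroup (completionOrder K p O)))) ∧
    (Psi K O' O I).ncard =
      (unitGroup (completionOrder K p O')).relIndex (unitGroup (completionOrder K p O)) ∧
    -- `I_p` is principal
    (∃ x : (CompletedAlgebra K B p)ˣ, completion K p I =
      rightTranslate (Subalgebra.toSubmodule (completionOrder K p O)) x) ∧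
    -- the list of the elements of `Ψ(I)`, for every generator `x` of `I_p` and every system
    -- `α` of representatives of `O'_pˣ \ O_pˣ`
    (∀ x : (CompletedAlgebra K B p)ˣ, completion K p I =
        rightTranslate (Subalgebra.toSubmodule (completionOrder K p O)) x →
      ∀ {ι : Type uι} (α : ι → (CompletedAlgebra K B p)ˣ),
        (∀ j, α j ∈ unitGroup (completionOrder K p O)) →
        (∀ u ∈ unitGroup (completionOrder K p O),
          ∃! j, u * (α j)⁻¹ ∈ unitGroup (completionOrder K p O')) →
        ∃ J : ι → Submodule R B,
          (∀ (j : ι) (M : Submodule R B), M = J j ↔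
            (Submodule.IsLattice K M ∧
              (∀ q : HeightOneSpectrum R, q ≠ p → completion K q M = completion K q I) ∧
              completion K p M =
                rightTranslate (Subalgebra.toSubmodule (completionOrder K p O'))
                  ((α j * x : (CompletedAlgebra K B p)ˣ) : CompletedAlgebra K B p))) ∧
          Function.Injective J ∧ Set.range J = Psi K O' O I) := by
  have h : ∀ r ∈ p.asIdeal ^ e, ∀ x ∈ O, r • x ∈ O' := fun r hr x hx => by
    have hr' : algebraMap R K r ∈ latticeIndex K (Subalgebra.toSubmodule O)
        (Subalgebra.toSubmodule O') := hindex ▸ ⟨r, hr, rfl⟩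
    rw [← algebraMap_smul K r x]
    exact smul_mem_of_mem_latticeIndex p hO hle hr' hx
  have hle' := completionOrder_mono (K := K) p hle
  have hdim' : Module.finrank (p.adicCompletion K) (CompletedAlgebra K B p) = 4 := by
    rw [Module.finrank_baseChange, hdim]
  have hprinc : ∀ {P : Subalgebra R B}, IsOrder K P →
      ∀ Λ ∈ leftIdeals (p.adicCompletion K) (completionOrder K p P),
        ∃ y : (CompletedAlgebra K B p)ˣ,
          Λ = rightTranslate (Subalgebra.toSubmodule (completionOrder K p P)) y :=
    fun hP Λ hΛ => exists_eq_rightTranslate hdim' (isOrder_completionOrder p hP) hΛ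
  -- A unit `α` of `O_p` turns a generator `x` of `I_p` into another one, so
  -- `localSubmodule_mem_Psi` applies with `y = α x`.
  have htr : ∀ {x α : (CompletedAlgebra K B p)ˣ}, α ∈ unitGroup (completionOrder K p O) →
      completion K p I = rightTranslate (Subalgebra.toSubmodule (completionOrder K p O)) x →
      completion K p I = rightTranslate (Subalgebra.toSubmodule (completionOrder K p O))
        ((α * x : (CompletedAlgebra K B p)ˣ) : CompletedAlgebra K B p) := by
    intro x α hα hx
    rw [hx]
    simpa using ((rightTranslate_eq_iff (α := 1) (β := α) x).mpr (by simpa using inv_mem hα))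
  obtain ⟨x₀, hx₀⟩ := hprinc hO _ (completion_mem_leftIdeals p hI)
  have hbij : Set.BijOn (completion K p) (Psi K O' O I)
      (Psi (p.adicCompletion K) (completionOrder K p O') (completionOrder K p O)
        (completion K p I)) := by
    refine ⟨fun J hJ => completion_mem_Psi p hJ, injOn_completion_Psi h, fun Λ hΛ => ?_⟩
    obtain ⟨y, rfl⟩ := hprinc hO' Λ hΛ.1
    obtain ⟨α, hα, rfl⟩ := exists_unit_of_mem_Psi hle' (hx₀ ▸ hΛ)
    exact ⟨_, localSubmodule_mem_Psi hO hO' hle h hI (htr hα hx₀),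
      completion_localSubmodule_rightTranslate hle h (htr hα hx₀)⟩
  obtain ⟨ε⟩ := nonempty_quotient_equiv_Psi (isOrder_completionOrder p hO') hle' x₀ (hprinc hO')
  rw [← hx₀] at ε
  have ε' := hbij.equiv.trans ε.symm
  refine ⟨hbij, ?_, ?_, ⟨x₀, hx₀⟩, ?_⟩
  · rw [← Cardinal.mk_uLift]
    exact Cardinal.mk_congr (Equiv.ulift.trans ε')
  -- Both sides are values of `Nat.card`, so in the infinite case both are 0.
  · rw [← Nat.card_coe_set_eq, Subgroup.relIndex, Subgroup.index]
    exact Nat.card_congr ε'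
  · intro x hx ι α hα huniq
    have hIlat : Submodule.IsLattice K I := hI.1.isLattice
    have hmem j := localSubmodule_mem_Psi hO hO' hle h hI (htr (hα j) hx)
    have hcomp j := completion_localSubmodule_rightTranslate hle h (htr (hα j) hx)
    refine ⟨fun j => localSubmodule I (rightTranslate
      (Subalgebra.toSubmodule (completionOrder K p O'))
        ((α j * x : (CompletedAlgebra K B p)ˣ) : CompletedAlgebra K B p)), fun j M => ?_, ?_, ?_⟩
    · have hlat := (hmem j).1.1.isLattice
      have hne : ∀ q : HeightOneSpectrum R, q ≠ p → completion K q _ = completion K q I :=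
        fun q hq => completion_eq_of_ne (le_of_mem_Psi (hmem j))
          (smul_mem_of_mem_Psi h (hmem j)) hq
      constructor
      · rintro rfl
        exact ⟨hlat, hne, hcomp j⟩
      · rintro ⟨hM, hMq, hMp⟩
        refine eq_of_forall_completion_eq p M _ fun q => ?_
        by_cases hq : q = p
        · subst hq
          rw [hMp, hcomp]
        · rw [hMq q hq, hne q hq]
    · intro i j hij
      have hij' := congrArg (completion K p) hij
      simp only [hcomp] at hij'
      rw [rightTranslate_eq_iff] at hij'
      -- Both `i` and `j` represent the coset of `α i`.
      exact (huniq (α i) (hα i)).unique (by simp [one_mem]) hij'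
    · refine Set.Subset.antisymm (Set.range_subset_iff.mpr hmem) fun M hM => ?_
      have hMp := completion_mem_Psi p hM
      obtain ⟨y, hy⟩ := hprinc hO' _ hMp.1
      rw [hy, hx] at hMp
      obtain ⟨u, hu, rfl⟩ := exists_unit_of_mem_Psi hle' hMp
      obtain ⟨j, hj, -⟩ := huniq u hu
      refine ⟨j, injOn_completion_Psi h (hmem j) hM ?_⟩
      rw [hcomp, hy]
      exact ((rightTranslate_eq_iff x).mpr hj).symm
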